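/- **Setting.** Consider $x_{k+1}=Ax_k+Bu_k+B_ww_k$ with $x_k\in\mathbb R^n$, $u_k\in\mathbb R^m$, where $w_k$ are realizations of i.i.d. zero-mean random vectors $W_k$ in $\mathbb R^{m_w}$ whose support $\mathbb W$ is bounded and convex. Let $Q\succ0$, $R\succ0$, let $K$ be such that $A_{cl}=A+BK$ is Schur, and let $P$ solve $A_{cl}^\top PA_{cl}+Q+K^\top RK=P$. Let $H\in\mathbb R^{p\times n},h\in\mathbb R^p$, $G\in\mathbb R^{q\times m},g\in\mathbb R^q$, $\varepsilon\in[0,1]^p$, $\varepsilon_u,\varepsilon_f\in[0,1)$, and let $T\ge1$ be the horizon. Put $e_0=0$, $e_{l+1}=A_{cl}e_l+B_wW_l$. Define $[\eta_l]_j=\max\{\eta:\mathbb P\{\eta\le[h]_j-[H]_je_l\}\ge1-[\varepsilon]_j\}$ and $[\mu_l]_j=\max\{\mu:\mathbb P\{\mu\le[g]_j-[GK]_je_l\}\ge1-\varepsilon_u\}$ (a maximum equal to $+\infty$ means no constraint). Let $\mathbb X_f=\{x: H_fx\le h_f\}$ be robust positively invariant for $x^+=A_{cl}x+B_ww$, $w\in\mathbb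 W$, and contained in $\{x:HA_{cl}x\le\eta_1,\ GKx\le g\}$; put $[\eta_{f,l}]_j=\max\{\eta:\mathbb P\{\eta\le[h_f]_j-[H_f]_je_l\}\ge1-\varepsilon_f\}$ and $\eta_f=\eta_{f,T}$. *Constraint tightening.* Use either the bounds $\eta_l$ ($1\le l\le T$), $\mu_l$ ($0\le l\le T-1$), $\eta_f$, or, for a convex set $\mathbb W_f\subseteq\mathbb W$ with $\mathbb P\{W_k\in\mathbb W_f\}\ge1-\varepsilon_f$, replace them by $[\tilde\eta_l]_j=\min_{0\le i\le l-1}\{\inf_{w_\kappa\in\mathbb W_f}-[H]_j\sum_{\kappa=1}^iA_{cl}^{l-\kappa}B_ww_\kappa+[\eta_{l-i}]_j\}$, $[\tilde\mu_l]_j=\min_{0\le i\le l}\{\inf_{w_\kappa\in\mathbb W_f}-[GK]_j\sum_{\kappa=1}^iA_{cl}^{l-\kappa}B_ww_\kappa+[\mu_{l-i}]_j\}$, $[\tilde\eta_f]_j=\min_{0\le i\le T}\{\inf_{w_\kappa\in\mathbb W_f}-[H_f]_j\sum_{\kappa=1}^iA_{cl}^{T-\kappa}B_ww_\kappa+[\eta_{f,T-i}]_j\}$.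 Write again $\eta_l,\mu_l,\eta_f$ for the chosen bounds. *Controller.* Let $C_T$ be the set of $(x,u)$ for which there are $v_0=u,v_1,\dots,v_{T-1}$ such that $z_0=x$, $z_{l+1}=Az_l+Bv_l$ satisfies $Hz_l\le\eta_l$ ($1\le l\le T$), $Gv_l\le\mu_l$ ($0\le l\le T-1$), $H_fz_T\le\eta_f$. Let $C^0_{T,x}$ be the projection of $C_T$ to the $x$-coordinates, $C^{i+1}_{T,x}=\{x\in C^i_{T,x}:\exists u,\ (x,u)\in C_T,\ Ax+Bu\in C^i_{T,x}\ominus B_w\mathbb W\}$ and $C^\infty_{T,x}=\bigcap_iC^i_{T,x}$, where $S\ominus D=\{a\in S: a+d\in S\ \forall d\in D\}$. At state $x_k$ the controller minimizes $\sum_{l=0}^{T-1}(z_l^\top Qz_l+v_l^\top Rv_l)+z_T^\top Pz_T$ over $(v_0,\dots,v_{T-1})$ subject to the constraints above with $z_0=x_k$ and to the first step constraint $z_1\in C^\infty_{T,x}\ominus B_w\mathbb W$, and applies $u_k=v_0^*$, the first element of the minimizer (a measurable function of $x_k$). The candidate plan at time $k+1$ is $\tilde v_i=v^*_{i+1}+KA_{cl}^iB_ww_k$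 ($0\le i\le T-2$), $\tilde v_{T-1}=K(z^*_T+A_{cl}^{T-1}B_ww_k)$. The maximum probability, over the states $x_k\in C^\infty_{T,x}$, that the candidate plan is not feasible for the problem solved at $x_{k+1}$ is assumed to be smaller than $1$. **Theorem (Asymptotic Stability).** Assume moreover that * $u=Kx$ is the unconstrained LQ-optimal feedback (it minimizes $\sum_{k\ge0}(x_k^\top Qx_k+u_k^\top Ru_k)$ for $x_{k+1}=Ax_k+Bu_k$ from every initial state); * with $\mathbb X_\infty$ the minimal (closed, nonempty) robust positively invariant set of $x^+=A_{cl}x+B_ww$, $w\in\mathbb W$, and $\mathbb B$ the open unit ball, $\mathbb X_\infty\oplus\lambda\mathbb B\subseteq\mathbb X_f$ for some $\lambda>0$; * $C^\infty_{T,x}$ is compact. Then $\mathbb X_\infty$ is asymptotically stable in probability for the closed loop, with region of attraction $C^\infty_{T,x}$. That is, $\mathbb X_\infty$ is compact, $C^\infty_{T,x}$ is a neighborhood of it, and, with $\|x\|_{\mathbb X_\infty}$ the distance of $x$ to $\mathbb X_\infty$: for all $\varepsilon>0$ and $\rho\in[0,1)$ there is $\delta>0$ such that $\|x_0\|_{\mathbb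 X_\infty}\le\delta$ implies $\mathbb P\{\sup_{k\ge0}\|x_k\|_{\mathbb X_\infty}\ge\varepsilon\}\le1-\rho$; and for all $\varepsilon_2>0$ and all $x_0\in C^\infty_{T,x}$, $\lim_{k'\to\infty}\mathbb P\{\sup_{k>k'}\|x_k\|_{\mathbb X_\infty}<\varepsilon_2\}=1$. -/

import Mathlib

open MeasureTheory ProbabilityTheory Filter Topology
open scoped ENNReal

noncomputable section

namespace SMPC

/-- Euclidean space `ℝⁿ`. -/
abbrev E (n : ℕ) : Type := EuclideanSpace ℝ (Fin n)

/-- Matrix-vector product between Euclidean spaces. -/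
def mv {a b : ℕ} (M : Matrix (Fin a) (Fin b) ℝ) (x : E b) : E a :=
  WithLp.toLp 2 (M.mulVec x.ofLp)

/-- The quadratic form `xᵀ M x`. -/
def quad {a : ℕ} (M : Matrix (Fin a) (Fin a) ℝ) (x : E a) : ℝ :=
  x.ofLp ⬝ᵥ M.mulVec x.ofLp

/-- A matrix is Schur if all its complex eigenvalues lie in the open unit disc. -/
def IsSchur {a : ℕ} (M : Matrix (Fin a) (Fin a) ℝ) : Prop :=
  ∀ z ∈ spectrum ℂ (M.map (algebraMap ℝ ℂ)), ‖z‖ < 1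

/-- Pontryagin difference `S ⊖ B = {a ∈ S | a + b ∈ S for all b ∈ B}`. -/
def pdiff {a : ℕ} (S B : Set (E a)) : Set (E a) :=
  {x | x ∈ S ∧ ∀ b ∈ B, x + b ∈ S}

/-- The raw data of the control problem: system `x⁺ = A x + B u + Bw w`, law `ν` of the disturbance,
cost weights, feedback gain, state constraints `H x ≤ h` with violation levels `ε`, hard input
constraints `G u ≤ g`, prediction level `εu` for the inputs, terminal polytope `Hf x ≤ hf` with
level `εf`, and horizon `T`. -/
structure Data (n m mw p q r : ℕ) where
  A : Matrix (Fin n) (Fin n) ℝ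
  B : Matrix (Fin n) (Fin m) ℝ
  Bw : Matrix (Fin n) (Fin mw) ℝ
  ν : Measure (E mw)
  ν_prob : IsProbabilityMeasure ν
  Q : Matrix (Fin n) (Fin n) ℝ
  R : Matrix (Fin m) (Fin m) ℝ
  P : Matrix (Fin n) (Fin n) ℝ
  K : Matrix (Fin m) (Fin n) ℝ
  H : Matrix (Fin p) (Fin n) ℝ
  h : Fin p → ℝ
  ε : Fin p → ℝ
  G : Matrix (Fin q) (Fin m) ℝ
  g : Fin q → ℝ
  εu : ℝ
  Hf : Matrix (Fin r) (Fin n) ℝ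
  hf : Fin r → ℝ
  εf : ℝ
  T : ℕ

/-- Right-hand sides of the nominal constraints: `H z_l ≤ state l`, `G v_l ≤ input l`,
`Hf z_T ≤ term`. The value `⊤` means that a row imposes no constraint. -/
structure Tightening (p q r : ℕ) where
  state : ℕ → Fin p → EReal
  input : ℕ → Fin q → EReal
  term : Fin r → EReal

namespace Data

variable {n m mw p q r : ℕ} (D : Data n m mw p q r)

instance : IsProbabilityMeasure D.ν := D.ν_prob

/-- The disturbance set: the support of the law of the disturbance. -/
def WW : Set (E mw) := D.ν.support

/-- The image of the disturbance set under `Bw`. -/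
def BwW : Set (E n) := mv D.Bw '' D.WW

/-- `A + B K`. -/
def Acl : Matrix (Fin n) (Fin n) ℝ := D.A + D.B * D.K

/-! ### Nominal predictions, costs, LQ-optimality -/

/-- Nominal trajectory `z_{l+1} = A z_l + B v_l`, `z_0 = x`. -/
def nom (x : E n) (v : ℕ → E m) : ℕ → E n
  | 0 => x
  | l + 1 => mv D.A (nom x v l) + mv D.B (v l)

/-- Finite horizon cost (without the additive constant caused by the prediction error). Only the
first `T` entries of `v` enter. -/
def cost (x : E n) (v : ℕ → E m) : ℝ :=
  (∑ l ∈ Finset.range D.T, (quad D.Q (D.nom x v l) + quad D.R (v l)))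
    + quad D.P (D.nom x v D.T)

/-- Unconstrained infinite horizon quadratic cost of an input sequence. -/
def lqCost (x : E n) (u : ℕ → E m) : ℝ≥0∞ :=
  ∑' k, ENNReal.ofReal (quad D.Q (D.nom x u k) + quad D.R (u k))

/-- The feedback `u = K x` is optimal for the unconstrained infinite horizon LQ problem, from every
initial state and among all input sequences. -/
def IsLQOptimal : Prop :=
  ∀ (x : E n) (u : ℕ → E m), D.lqCost x (fun k => mv D.K (mv (D.Acl ^ k) x)) ≤ D.lqCost x u

/-! ### Constraint tightening -/

/-- Law of the prediction error `e_l`, where `e_0 = 0` and `e_{l+1} = Acl e_l + Bw W` with `W`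
distributed according to `ν` and independent of `e_l`. -/
def errLaw : ℕ → Measure (E n)
  | 0 => Measure.dirac 0
  | l + 1 => ((errLaw l).prod D.ν).map (fun y => mv D.Acl y.1 + mv D.Bw y.2)

/-- The largest `η` with `Pr{η ≤ c - a e_l} ≥ 1 - δ`. -/
def chanceBound (a : E n → ℝ) (c δ : ℝ) (l : ℕ) : EReal :=
  sSup ((fun η : ℝ => (η : EReal)) ''
    {η : ℝ | ENNReal.ofReal (1 - δ) ≤ D.errLaw l {e | η ≤ c - a e}})

/-- State bound `[η_l]_j`. -/
def eta (l : ℕ) (j : Fin p) : EReal :=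
  D.chanceBound (fun e => mv D.H e j) (D.h j) (D.ε j) l

/-- Input bound `[μ_l]_j`. -/
def mu (l : ℕ) (j : Fin q) : EReal :=
  D.chanceBound (fun e => mv (D.G * D.K) e j) (D.g j) D.εu l

/-- Terminal bound `[η_{f,l}]_j`, computed with the error `e_l`. -/
def etaf (l : ℕ) (j : Fin r) : EReal :=
  D.chanceBound (fun e => mv D.Hf e j) (D.hf j) D.εf l

/-- The stochastic tightening. -/
def plain : Tightening p q r where
  state := D.eta
  input := D.mu
  term := D.etaf D.T

/-- The minimum of `- a (∑_{κ=1}^{i} Acl^{l-κ} Bw w_κ)` over `w_1, …, w_i ∈ Wf`. -/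
def hatBound (Wf : Set (E mw)) (a : E n → ℝ) (i l : ℕ) : EReal :=
  ⨅ (w : ℕ → E mw) (_ : ∀ κ, w κ ∈ Wf),
    ((-(a (∑ κ ∈ Finset.Icc 1 i, mv (D.Acl ^ (l - κ)) (mv D.Bw (w κ)))) : ℝ) : EReal)

/-- The refined tightening, worst case over a confidence region `Wf` in the first steps and
stochastic in the remaining ones. -/
def refined (Wf : Set (E mw)) : Tightening p q r where
  state := fun l j =>
    ⨅ i : Fin l, D.hatBound Wf (fun e => mv D.H e j) i l + D.eta (l - i) j
  input := fun l j =>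
    ⨅ i : Fin (l + 1), D.hatBound Wf (fun e => mv (D.G * D.K) e j) i l + D.mu (l - i) j
  term := fun j =>
    ⨅ i : Fin (D.T + 1), D.hatBound Wf (fun e => mv D.Hf e j) i D.T + D.etaf (D.T - i) j

/-- The two admissible constraint tightenings: the stochastic one, or the refined one for a convex
confidence region `Wf ⊆ 𝕎` of level `1 - εf`. -/
def IsTightening (τ : Tightening p q r) : Prop :=
  τ = D.plain ∨
    ∃ Wf : Set (E mw), Wf ⊆ D.WW ∧ Convex ℝ Wf ∧ ENNReal.ofReal (1 - D.εf) ≤ D.ν Wf ∧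
      τ = D.refined Wf

/-! ### Invariant sets -/

/-- Robust positive invariance for `x⁺ = Acl x + Bw w`, `w ∈ 𝕎`. -/
def IsRPI (S : Set (E n)) : Prop :=
  ∀ x ∈ S, ∀ w ∈ D.WW, mv D.Acl x + mv D.Bw w ∈ S

/-- The minimal robust positively invariant set: the intersection of all nonempty closed robust
positively invariant sets. -/
def Xinf : Set (E n) :=
  ⋂₀ {S | S.Nonempty ∧ IsClosed S ∧ D.IsRPI S}

/-- The polyhedron `Hf x ≤ hf`. -/
def Xf : Set (E n) := {x | ∀ j, mv D.Hf x j ≤ D.hf j}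

/-- States in which `u = K x` satisfies the one-step chance constraints and the input constraints. -/
def XfTilde : Set (E n) :=
  {x | (∀ j, ((mv (D.H * D.Acl) x j : ℝ) : EReal) ≤ D.eta 1 j) ∧
    ∀ j, mv (D.G * D.K) x j ≤ D.g j}

/-! ### The optimization problem -/

/-- Feasibility of the input sequence `v` at `x` without first step constraint. -/
def NomFeasible (τ : Tightening p q r) (x : E n) (v : ℕ → E m) : Prop :=
  (∀ l, 1 ≤ l → l ≤ D.T → ∀ j, ((mv D.H (D.nom x v l) j : ℝ) : EReal) ≤ τ.state l j) ∧
  (∀ l, l < D.T → ∀ j, ((mv D.G (v l) j : ℝ) : EReal) ≤ τ.input l j) ∧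
  (∀ j, ((mv D.Hf (D.nom x v D.T) j : ℝ) : EReal) ≤ τ.term j)

/-- The set `C_T` of feasible states and first inputs. -/
def CT (τ : Tightening p q r) : Set (E n × E m) :=
  {y | ∃ v : ℕ → E m, v 0 = y.2 ∧ D.NomFeasible τ y.1 v}

/-- The recursion `C_{T,x}^i`. -/
def CTx (τ : Tightening p q r) : ℕ → Set (E n)
  | 0 => Prod.fst '' D.CT τ
  | i + 1 => {x | x ∈ CTx τ i ∧
      ∃ u : E m, (x, u) ∈ D.CT τ ∧ mv D.A x + mv D.B u ∈ pdiff (CTx τ i) D.BwW}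

/-- The set `C_{T,x}^∞`. -/
def CTinf (τ : Tightening p q r) : Set (E n) := ⋂ i, D.CTx τ i

/-- Feasibility for the problem solved online, i.e. with the first step constraint. -/
def Feasible (τ : Tightening p q r) (x : E n) (v : ℕ → E m) : Prop :=
  D.NomFeasible τ x v ∧ D.nom x v 1 ∈ pdiff (D.CTinf τ) D.BwW

/-- `v` is a minimizer of the problem solved online at `x`. -/
def IsOptimal (τ : Tightening p q r) (x : E n) (v : ℕ → E m) : Prop :=
  D.Feasible τ x v ∧ ∀ v', D.Feasible τ x v' → D.cost x v ≤ D.cost x v'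

/-- `π` maps every state at which the online problem is feasible to a minimizer. -/
def IsOptimalPlan (τ : Tightening p q r) (π : E n → ℕ → E m) : Prop :=
  ∀ x, (∃ v, D.Feasible τ x v) → D.IsOptimal τ x (π x)

/-! ### Closed loop and candidate solution -/

/-- Closed loop under the feedback `κ` and the disturbance sequence `w`, started at `x₀`. -/
def closedLoop (κ : E n → E m) (w : ℕ → E mw) (x₀ : E n) : ℕ → E n
  | 0 => x₀
  | k + 1 => mv D.A (closedLoop κ w x₀ k) + mv D.B (κ (closedLoop κ w x₀ k)) + mv D.Bw (w k)

/-- The shifted candidate plan obtained from the plan `v` at `x` when the disturbance is `w`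
(entries `0, …, T - 1` matter). -/
def candidate (x : E n) (v : ℕ → E m) (w : E mw) (i : ℕ) : E m :=
  if i + 1 < D.T then v (i + 1) + mv D.K (mv (D.Acl ^ i) (mv D.Bw w))
  else mv D.K (D.nom x v D.T + mv (D.Acl ^ i) (mv D.Bw w))

/-- The maximal probability, over the states of `C_{T,x}^∞`, that the shifted optimal plan is not
feasible at the next time. -/
def maxInfeasProb (τ : Tightening p q r) (π : E n → ℕ → E m) : ℝ≥0∞ :=
  ⨆ x ∈ D.CTinf τ, D.ν {w | ¬ D.Feasible τ
    (mv D.A x + mv D.B (π x 0) + mv D.Bw w) (D.candidate x (π x) w)}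

end Data

/-- The compact set `S` is asymptotically stable in probability, with region of attraction `N`, for
the family `X x₀ k` of processes indexed by the initial state `x₀`. -/
def AsympStableInProb {n : ℕ} {Ω : Type*} [MeasurableSpace Ω] (Pr : Measure Ω)
    (X : E n → ℕ → Ω → E n) (S N : Set (E n)) : Prop :=
  IsCompact S ∧ N ∈ 𝓝ˢ S ∧
  (∀ ε : ℝ, 0 < ε → ∀ ρ : ℝ, 0 ≤ ρ → ρ < 1 → ∃ δ : ℝ, 0 < δ ∧
    ∀ x₀, Metric.infEDist x₀ S ≤ ENNReal.ofReal δ →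
      Pr {ω | ENNReal.ofReal ε ≤ ⨆ k, Metric.infEDist (X x₀ k ω) S} ≤ ENNReal.ofReal (1 - ρ)) ∧
  (∀ ε₂ : ℝ, 0 < ε₂ → ∀ x₀ ∈ N,
    Tendsto (fun k' : ℕ =>
      Pr {ω | (⨆ (k : ℕ) (_ : k' < k), Metric.infEDist (X x₀ k ω) S) < ENNReal.ofReal ε₂})
      atTop (𝓝 1))

end SMPC

end

/-!
The argument separates what happens inside the terminal region from how it is reached.

*Inside.* Robust invariance of the terminal region `Xf` makes the plan `u = K z` feasible there for
either tightening (`nomFeasible_feedback`), so `Xf ⊆ C_{T,x}^∞`. LQ-optimality of `K` removes the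
linear term when the square is completed, which gives
`cost x v = xᵀ P x + ∑ dₗᵀ (R + Bᵀ P B) dₗ` with `dₗ = vₗ - K zₗ` (`cost_eq`). The plan `u = K z` has
all `dₗ = 0`, hence the controller equals `K` on `Xf` (`plan_eq_of_mem_Xf`). The closed loop never
leaves `Xf` again and approaches the minimal invariant set like `‖Aclʲ‖`, which tends to zero. As
`Xf` is a neighbourhood of that set, stability holds with probability one.

*Reaching.* The excess `∑ dₗᵀ (R + Bᵀ P B) dₗ` of the optimal plan is a Lyapunov function along
steps for which the shifted plan is feasible: it decreases by the excess of the applied input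
(`excessSum_step_le`). It is bounded on `C_{T,x}^∞`, so only a bounded number of those steps can use
a large deviation from `K`, and a long enough run of small deviations ends in `Xf`. This gives a
number `N` such that `N` such steps lead from any state of `C_{T,x}^∞` into `Xf`
(`exists_subset_reach`). Each step has this property with probability at least `1 - maxInfeasProb`,
so `Xf` is missed for `N` steps with probability at most some `γ < 1`, and by the Markov property
for `k N` steps with probability at most `γᵏ` (`tendsto_missProb`).

Two facts about the online problem rest on polyhedral geometry: it is feasible on all of
`C_{T,x}^∞`, and the feasible plans can be chosen bounded there. Both follow from Fourier–Motzkin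
elimination with a selection of linear growth (`IsPolyhedron.eliminate`): the sets `C_{T,x}^i` are
polyhedra, and they are eventually bounded as their intersection is compact.
-/

noncomputable section

namespace SMPC

/-! ### Matrix-vector products on Euclidean space -/

lemma mv_add {a b : ℕ} (M : Matrix (Fin a) (Fin b) ℝ) (x y : E b) :
    mv M (x + y) = mv M x + mv M y := by
  ext i; simp [mv, Matrix.mulVec_add]

lemma mv_smul {a b : ℕ} (M : Matrix (Fin a) (Fin b) ℝ) (c : ℝ) (x : E b) :
    mv M (c • x) = c • mv M x := by
  ext i; simp [mv, Matrix.mulVec_smul]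

/-- The matrix-vector product as a continuous linear map. -/
def mvL {a b : ℕ} (M : Matrix (Fin a) (Fin b) ℝ) : E b →L[ℝ] E a :=
  LinearMap.toContinuousLinearMap
    { toFun := mv M, map_add' := mv_add M, map_smul' := mv_smul M }

@[simp] lemma mvL_apply {a b : ℕ} (M : Matrix (Fin a) (Fin b) ℝ) (x : E b) :
    mvL M x = mv M x := rfl

@[simp] lemma mv_zero {a b : ℕ} (M : Matrix (Fin a) (Fin b) ℝ) : mv M 0 = 0 :=
  (mvL M).map_zero

lemma mv_sub {a b : ℕ} (M : Matrix (Fin a) (Fin b) ℝ) (x y : E b) :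
    mv M (x - y) = mv M x - mv M y := (mvL M).map_sub x y

lemma mv_mul {a b c : ℕ} (M : Matrix (Fin a) (Fin b) ℝ) (N : Matrix (Fin b) (Fin c) ℝ) (x : E c) :
    mv (M * N) x = mv M (mv N x) := by
  simp [mv, Matrix.mulVec_mulVec]

lemma add_mv {a b : ℕ} (M N : Matrix (Fin a) (Fin b) ℝ) (x : E b) :
    mv (M + N) x = mv M x + mv N x := by
  ext i; simp [mv, Matrix.add_mulVec]

@[simp] lemma one_mv {a : ℕ} (x : E a) : mv (1 : Matrix (Fin a) (Fin a) ℝ) x = x := by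
  simp [mv]

lemma pow_succ_mv {a : ℕ} (M : Matrix (Fin a) (Fin a) ℝ) (k : ℕ) (x : E a) :
    mv (M ^ (k + 1)) x = mv M (mv (M ^ k) x) := by
  rw [pow_succ', mv_mul]

lemma pow_succ_mv' {a : ℕ} (M : Matrix (Fin a) (Fin a) ℝ) (k : ℕ) (x : E a) :
    mv (M ^ (k + 1)) x = mv (M ^ k) (mv M x) := by
  rw [pow_succ, mv_mul]

lemma continuous_mv {a b : ℕ} (M : Matrix (Fin a) (Fin b) ℝ) : Continuous (mv M) :=
  (mvL M).continuous

/-! ### Quadratic forms -/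

lemma quad_eq_inner {a : ℕ} (M : Matrix (Fin a) (Fin a) ℝ) (x : E a) :
    quad M x = inner ℝ x (mv M x) := by
  rw [EuclideanSpace.inner_eq_star_dotProduct, dotProduct_comm]
  simp [quad, mv]

lemma continuous_quad {a : ℕ} (M : Matrix (Fin a) (Fin a) ℝ) : Continuous (quad M) := by
  have : quad M = fun x => inner ℝ x (mv M x) := funext (quad_eq_inner M)
  rw [this]
  exact continuous_id.inner (continuous_mv M)

@[simp] lemma quad_zero {a : ℕ} (M : Matrix (Fin a) (Fin a) ℝ) : quad M 0 = 0 := by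
  simp [quad_eq_inner]

/-- The symmetrized polar form of `quad M`. -/
def polar {a : ℕ} (M : Matrix (Fin a) (Fin a) ℝ) (x y : E a) : ℝ :=
  inner ℝ x (mv M y) + inner ℝ y (mv M x)

lemma quad_add {a : ℕ} (M : Matrix (Fin a) (Fin a) ℝ) (x y : E a) :
    quad M (x + y) = quad M x + polar M x y + quad M y := by
  simp only [quad_eq_inner, polar, mv_add, inner_add_left, inner_add_right]; ring

lemma quad_smul {a : ℕ} (M : Matrix (Fin a) (Fin a) ℝ) (c : ℝ) (x : E a) :
    quad M (c • x) = c ^ 2 * quad M x := by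
  simp only [quad_eq_inner, mv_smul, inner_smul_left, inner_smul_right, RCLike.conj_to_real]; ring

lemma polar_smul_right {a : ℕ} (M : Matrix (Fin a) (Fin a) ℝ) (c : ℝ) (x y : E a) :
    polar M x (c • y) = c * polar M x y := by
  simp only [polar, mv_smul, inner_smul_left, inner_smul_right, RCLike.conj_to_real]; ring

lemma inner_mv_transpose {a b : ℕ} (M : Matrix (Fin a) (Fin b) ℝ) (x : E b) (y : E a) :
    inner ℝ x (mv M.transpose y) = inner ℝ (mv M x) y := by
  simp only [EuclideanSpace.inner_eq_star_dotProduct, mv, star_trivial]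
  rw [Matrix.mulVec_transpose, ← Matrix.dotProduct_mulVec]

lemma quad_transpose_mul_mul {a b : ℕ} (M : Matrix (Fin a) (Fin a) ℝ) (N : Matrix (Fin a) (Fin b) ℝ)
    (x : E b) : quad (N.transpose * M * N) x = quad M (mv N x) := by
  rw [quad_eq_inner, quad_eq_inner, Matrix.mul_assoc, mv_mul, inner_mv_transpose, mv_mul]

lemma add_quad {a : ℕ} (M N : Matrix (Fin a) (Fin a) ℝ) (x : E a) :
    quad (M + N) x = quad M x + quad N x := by
  simp only [quad_eq_inner, add_mv, inner_add_right]

lemma quad_pos {a : ℕ} {M : Matrix (Fin a) (Fin a) ℝ} (hM : M.PosDef) {x : E a} (hx : x ≠ 0) :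
    0 < quad M x := by
  have := hM.dotProduct_mulVec_pos (x := x.ofLp) (by simpa using hx)
  simpa [quad] using this

lemma quad_nonneg {a : ℕ} {M : Matrix (Fin a) (Fin a) ℝ} (hM : M.PosDef) (x : E a) :
    0 ≤ quad M x := by
  rcases eq_or_ne x 0 with rfl | hx
  · simp
  · exact (quad_pos hM hx).le

/-- A positive definite form is bounded below by a multiple of the squared norm. -/
lemma exists_le_quad {a : ℕ} {M : Matrix (Fin a) (Fin a) ℝ} (hM : M.PosDef) :
    ∃ c : ℝ, 0 < c ∧ ∀ x, c * ‖x‖ ^ 2 ≤ quad M x := by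
  rcases (Metric.sphere (0 : E a) 1).eq_empty_or_nonempty with he | hne
  · refine ⟨1, one_pos, fun x => ?_⟩
    rcases eq_or_ne x 0 with rfl | hx
    · simp
    · exfalso
      have : (‖x‖⁻¹ • x) ∈ Metric.sphere (0 : E a) 1 := by
        simp [norm_smul, inv_mul_cancel₀ (norm_ne_zero_iff.2 hx)]
      simp [he] at this
  · obtain ⟨y, hy, hmin⟩ := (isCompact_sphere (0 : E a) 1).exists_isMinOn hne
      (continuous_quad M).continuousOn
    have hy0 : y ≠ 0 := by
      rintro rfl; simp at hy
    refine ⟨quad M y, quad_pos hM hy0, fun x => ?_⟩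
    rcases eq_or_ne x 0 with rfl | hx
    · simp
    · have hx' := norm_ne_zero_iff.2 hx
      have h1 : quad M y ≤ quad M (‖x‖⁻¹ • x) := hmin (by simp [norm_smul, inv_mul_cancel₀ hx'])
      have h2 : x = ‖x‖ • (‖x‖⁻¹ • x) := by rw [smul_smul, mul_inv_cancel₀ hx', one_smul]
      calc quad M y * ‖x‖ ^ 2 ≤ quad M (‖x‖⁻¹ • x) * ‖x‖ ^ 2 := by gcongr
        _ = quad M (‖x‖ • (‖x‖⁻¹ • x)) := by rw [quad_smul M ‖x‖]; ring
        _ = quad M x := by rw [← h2]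

/-! ### Powers of Schur matrices -/

lemma norm_toLp_ofReal {a : ℕ} (x : E a) :
    ‖(WithLp.toLp 2 (fun i => ((x i : ℝ) : ℂ)) : EuclideanSpace ℂ (Fin a))‖ = ‖x‖ := by
  simp [EuclideanSpace.norm_eq]

/-- Powers of a Schur matrix tend to zero in operator norm, by Gelfand's formula over `ℂ`. -/
lemma IsSchur.tendsto_norm_pow {a : ℕ} {M : Matrix (Fin a) (Fin a) ℝ} (hM : IsSchur M) :
    Tendsto (fun k => ‖mvL (M ^ k)‖) atTop (𝓝 0) := by
  rcases Nat.eq_zero_or_pos a with rfl | ha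
  · have : ∀ k, ‖mvL (M ^ k)‖ = 0 := fun k => by
      have : mvL (M ^ k) = 0 := by ext x i; exact i.elim0
      simp [this]
    simp [this]
  have : Nonempty (Fin a) := ⟨⟨0, ha⟩⟩
  set φ := Matrix.toEuclideanCLM (n := Fin a) (𝕜 := ℂ)
  set MC : Matrix (Fin a) (Fin a) ℂ := M.map (algebraMap ℝ ℂ)
  set L : EuclideanSpace ℂ (Fin a) →L[ℂ] EuclideanSpace ℂ (Fin a) := φ MC with hL
  have hspec : ∀ z ∈ spectrum ℂ L, ‖z‖₊ < (1 : NNReal) := by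
    intro z hz
    have : spectrum ℂ L = spectrum ℂ MC := AlgEquiv.spectrum_eq φ MC
    rw [this] at hz
    exact_mod_cast hM z hz
  have hr : spectralRadius ℂ L < (1 : NNReal) := spectrum.spectralRadius_lt_of_forall_lt L hspec
  have hlim := spectrum.pow_nnnorm_pow_one_div_tendsto_nhds_spectralRadius L
  obtain ⟨c, hc1, hc2⟩ := ENNReal.lt_iff_exists_nnreal_btwn.1 hr
  have hev : ∀ᶠ k : ℕ in atTop, ‖L ^ k‖ ≤ (c : ℝ) ^ k := by
    filter_upwards [hlim.eventually (gt_mem_nhds hc1), eventually_gt_atTop 0] with k hk hk0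
    have hk' : ((‖L ^ k‖₊ : ℝ≥0∞)) ≤ (c : ℝ≥0∞) ^ k := by
      have h1 := ENNReal.rpow_le_rpow hk.le (Nat.cast_nonneg k)
      rwa [← ENNReal.rpow_mul, one_div, inv_mul_cancel₀ (by positivity), ENNReal.rpow_one,
        ENNReal.rpow_natCast] at h1
    exact_mod_cast hk'
  have hle : ∀ k, ‖mvL (M ^ k)‖ ≤ ‖L ^ k‖ := by
    intro k
    refine ContinuousLinearMap.opNorm_le_bound _ (norm_nonneg _) fun x => ?_
    have h1 : (L ^ k) (WithLp.toLp 2 (fun i => ((x i : ℝ) : ℂ)))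
        = WithLp.toLp 2 (fun i => ((mv (M ^ k) x i : ℝ) : ℂ)) := by
      have : L ^ k = φ ((M ^ k).map (algebraMap ℝ ℂ)) := by
        rw [hL, ← map_pow]; congr 1
        exact (map_pow (algebraMap ℝ ℂ).mapMatrix M k).symm
      rw [this]
      ext i
      simp [φ, mv, Matrix.mulVec, dotProduct]
    rw [mvL_apply, ← norm_toLp_ofReal (mv (M ^ k) x), ← h1, ← norm_toLp_ofReal x]
    exact (L ^ k).le_opNorm _
  have hc : (c : ℝ) < 1 := by exact_mod_cast hc2
  refine squeeze_zero' (Eventually.of_forall fun k => norm_nonneg _)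
    (hev.mono fun k hk => (hle k).trans hk) (tendsto_pow_atTop_nhds_zero_of_lt_one c.2 hc)

lemma IsSchur.tendsto_mv_pow {a : ℕ} {M : Matrix (Fin a) (Fin a) ℝ} (hM : IsSchur M) (x : E a) :
    Tendsto (fun k => mv (M ^ k) x) atTop (𝓝 0) := by
  have h := hM.tendsto_norm_pow.mul_const ‖x‖
  rw [zero_mul] at h
  exact squeeze_zero_norm (fun k => (mvL (M ^ k)).le_opNorm x) h

/-! ### Polyhedra and Fourier–Motzkin elimination -/

/-- A polyhedron: the solution set of finitely many affine inequalities. -/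
def IsPolyhedron {X : Type*} [AddCommGroup X] [Module ℝ X] (S : Set X) : Prop :=
  ∃ (ι : Type) (_ : Fintype ι) (f : ι → X →ₗ[ℝ] ℝ) (c : ι → ℝ), S = {x | ∀ i, f i x ≤ c i}

namespace IsPolyhedron

section Basic

variable {X Y : Type*} [AddCommGroup X] [Module ℝ X] [AddCommGroup Y] [Module ℝ Y]

lemma halfspace (f : X →ₗ[ℝ] ℝ) (c : ℝ) : IsPolyhedron {x | f x ≤ c} :=
  ⟨Unit, inferInstance, fun _ => f, fun _ => c, by simp⟩

lemma iInter {κ : Type} [Fintype κ] {S : κ → Set X} (h : ∀ k, IsPolyhedron (S k)) :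
    IsPolyhedron (⋂ k, S k) := by
  choose ι hι f c hS using h
  refine ⟨Σ k, ι k, inferInstance, fun i => f i.1 i.2, fun i => c i.1 i.2, ?_⟩
  ext x
  simp [hS, Sigma.forall]

lemma inter {S S' : Set X} (h : IsPolyhedron S) (h' : IsPolyhedron S') :
    IsPolyhedron (S ∩ S') := by
  rw [Set.inter_eq_iInter]
  exact iInter (fun b => by cases b <;> assumption)

lemma preimage {S : Set Y} (h : IsPolyhedron S) (L : X →ₗ[ℝ] Y) : IsPolyhedron (L ⁻¹' S) := by
  obtain ⟨ι, hι, f, c, rfl⟩ := h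
  exact ⟨ι, hι, fun i => (f i).comp L, c, rfl⟩

protected lemma univ : IsPolyhedron (Set.univ : Set X) :=
  ⟨Empty, inferInstance, fun i => i.elim, fun i => i.elim, by ext; simp⟩

protected lemma empty : IsPolyhedron (∅ : Set X) :=
  ⟨Unit, inferInstance, fun _ => 0, fun _ => -1, by ext; simp⟩

/-- An affine inequality with extended real right-hand side defines a polyhedron. -/
lemma ereal_le (f : X →ₗ[ℝ] ℝ) (c : EReal) : IsPolyhedron {x | ((f x : ℝ) : EReal) ≤ c} := by
  induction c with
  | bot => simpa using IsPolyhedron.empty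
  | top => simpa using IsPolyhedron.univ
  | coe c => simpa using halfspace f c

lemma convex {S : Set X} (h : IsPolyhedron S) : Convex ℝ S := by
  obtain ⟨ι, hι, f, c, rfl⟩ := h
  rw [Set.ofPred_forall]
  exact convex_iInter fun i => convex_halfSpace_le (f i).isLinear (c i)

/-- The set of translations of a bounded set into a polyhedron is a polyhedron. -/
lemma setOf_forall_add_mem {S B : Set X} (h : IsPolyhedron S)
    (hB : ∀ f : X →ₗ[ℝ] ℝ, BddAbove (f '' B)) : IsPolyhedron {x | ∀ b ∈ B, x + b ∈ S} := by
  rcases B.eq_empty_or_nonempty with rfl | hne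
  · simpa using IsPolyhedron.univ
  obtain ⟨ι, hι, f, c, rfl⟩ := h
  refine ⟨ι, hι, f, fun i => c i - sSup (f i '' B), ?_⟩
  ext x
  simp only [Set.mem_ofPred_eq, map_add]
  constructor
  · intro h i
    rw [le_sub_iff_add_le, ← le_sub_iff_add_le']
    refine csSup_le (hne.image _) ?_
    rintro _ ⟨b, hb, rfl⟩
    linarith [h b hb i]
  · intro h b hb i
    have := le_csSup (hB (f i)) ⟨b, hb, rfl⟩
    linarith [h i]

end Basic

lemma isClosed {X : Type*} [NormedAddCommGroup X] [NormedSpace ℝ X] [FiniteDimensional ℝ X]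
    {S : Set X} (h : IsPolyhedron S) : IsClosed S := by
  obtain ⟨ι, hι, f, c, rfl⟩ := h
  rw [Set.ofPred_forall]
  exact isClosed_iInter fun i =>
    isClosed_le (LinearMap.continuous_of_finiteDimensional (f i)) continuous_const

end IsPolyhedron

/-- Between finitely many lower and upper bounds lies a number which is zero or one of the
bounds. -/
lemma exists_between_finset (Lo Up : Finset ℝ) (h : ∀ l ∈ Lo, ∀ u ∈ Up, l ≤ u) :
    ∃ t, (t = 0 ∨ t ∈ Lo ∨ t ∈ Up) ∧ (∀ l ∈ Lo, l ≤ t) ∧ ∀ u ∈ Up, t ≤ u := by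
  obtain ⟨u0, hu0, hmin⟩ := (insert 0 Up).exists_min_image id ⟨0, by simp⟩
  obtain ⟨t, ht, hmax⟩ := (insert u0 Lo).exists_max_image id ⟨u0, by simp⟩
  simp only [Finset.mem_insert, id] at hu0 hmin ht hmax
  refine ⟨t, ?_, fun l hl => hmax l (Or.inr hl), fun u hu => ?_⟩
  · rcases ht with rfl | ht
    · rcases hu0 with h0 | h0 <;> simp [h0]
    · exact Or.inr (Or.inl ht)
  · rcases ht with rfl | ht
    · exact hmin u (Or.inr hu)
    · exact h t ht u hu

/-- Elimination of one real variable. The projection of a polyhedron is a polyhedron, and its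
points have preimages of at most linear growth. -/
lemma IsPolyhedron.eliminate_real {X : Type*} [NormedAddCommGroup X] [NormedSpace ℝ X]
    [FiniteDimensional ℝ X] {S : Set (X × ℝ)} (h : IsPolyhedron S) :
    IsPolyhedron (Prod.fst '' S) ∧
      ∃ C : ℝ, 0 ≤ C ∧ ∀ x ∈ Prod.fst '' S, ∃ t : ℝ, (x, t) ∈ S ∧ ‖t‖ ≤ C * (1 + ‖x‖) := by
  classical
  obtain ⟨ι, hι, f, c, rfl⟩ := h
  set a : ι → X →ₗ[ℝ] ℝ := fun i => (f i).comp (LinearMap.inl ℝ X ℝ) with ha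
  set b : ι → ℝ := fun i => f i (0, 1) with hb
  have hf : ∀ i x t, f i (x, t) = a i x + t * b i := by
    intro i x t
    have : ((x, t) : X × ℝ) = (x, 0) + t • ((0 : X), (1 : ℝ)) := by simp
    rw [this, map_add, map_smul]; rfl
  set L : ι → X → ℝ := fun i x => (c i - a i x) / b i with hL
  -- The solutions after elimination.
  set S' : Set X := {x | (∀ i, b i = 0 → a i x ≤ c i) ∧
    ∀ i j, 0 < b i → b j < 0 → L j x ≤ L i x} with hS'
  set C : ℝ := ∑ i, (|c i| + ‖LinearMap.toContinuousLinearMap (a i)‖) / |b i| with hC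
  have hC0 : 0 ≤ C := Finset.sum_nonneg fun i _ => by positivity
  have hLC : ∀ i x, |L i x| ≤ C * (1 + ‖x‖) := by
    intro i x
    have h1 : |a i x| ≤ ‖LinearMap.toContinuousLinearMap (a i)‖ * ‖x‖ :=
      (LinearMap.toContinuousLinearMap (a i)).le_opNorm x
    have h2 : (|c i| + ‖LinearMap.toContinuousLinearMap (a i)‖) / |b i| ≤ C :=
      Finset.single_le_sum
        (f := fun i => (|c i| + ‖LinearMap.toContinuousLinearMap (a i)‖) / |b i|)
        (fun i _ => by positivity) (Finset.mem_univ i)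
    calc |L i x| = |c i - a i x| / |b i| := abs_div _ _
      _ ≤ ((|c i| + ‖LinearMap.toContinuousLinearMap (a i)‖) * (1 + ‖x‖)) / |b i| := by
        gcongr
        have := abs_sub (c i) (a i x)
        nlinarith [abs_nonneg (c i), norm_nonneg x,
          norm_nonneg (LinearMap.toContinuousLinearMap (a i)),
          mul_nonneg (abs_nonneg (c i)) (norm_nonneg x)]
      _ = (|c i| + ‖LinearMap.toContinuousLinearMap (a i)‖) / |b i| * (1 + ‖x‖) := by ring
      _ ≤ _ := by gcongr
  have hsol : ∀ x ∈ S', ∃ t : ℝ, (∀ i, f i (x, t) ≤ c i) ∧ ‖t‖ ≤ C * (1 + ‖x‖) := by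
    rintro x ⟨h0, h1⟩
    obtain ⟨t, ht, hlo, hup⟩ := exists_between_finset
      ((Finset.univ.filter fun j => b j < 0).image fun j => L j x)
      ((Finset.univ.filter fun i => 0 < b i).image fun i => L i x) (by
        simp only [Finset.mem_image, Finset.mem_filter, Finset.mem_univ, true_and]
        rintro _ ⟨j, hj, rfl⟩ _ ⟨i, hi, rfl⟩
        exact h1 i j hi hj)
    simp only [Finset.mem_image, Finset.mem_filter, Finset.mem_univ, true_and] at ht hlo hup
    refine ⟨t, fun i => ?_, ?_⟩
    · rw [hf]
      rcases lt_trichotomy (b i) 0 with hi | hi | hi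
      · have := hlo _ ⟨i, hi, rfl⟩
        rw [hL, div_le_iff_of_neg hi] at this
        linarith
      · rw [hi]; linarith [h0 i hi]
      · have := hup _ ⟨i, hi, rfl⟩
        rw [hL, le_div_iff₀ hi] at this
        linarith
    · rcases ht with rfl | ⟨j, -, rfl⟩ | ⟨j, -, rfl⟩
      · simp; positivity
      · exact hLC j x
      · exact hLC j x
  have hproj : Prod.fst '' {y : X × ℝ | ∀ i, f i y ≤ c i} = S' := by
    ext x
    constructor
    · rintro ⟨⟨x, t⟩, h, rfl⟩
      simp only [Set.mem_ofPred_eq, hf] at h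
      refine ⟨fun i hi => by simpa [hi] using h i, fun i j hi hj => ?_⟩
      have h1 : L j x ≤ t := by
        rw [hL, div_le_iff_of_neg hj]; linarith [h j]
      have h2 : t ≤ L i x := by
        rw [hL, le_div_iff₀ hi]; linarith [h i]
      exact h1.trans h2
    · intro hx
      obtain ⟨t, ht, -⟩ := hsol x hx
      exact ⟨(x, t), ht, rfl⟩
  rw [hproj]
  refine ⟨?_, C, hC0, hsol⟩
  have : S' = (⋂ i, {x | b i = 0 → a i x ≤ c i}) ∩
      ⋂ k : ι × ι, {x | 0 < b k.1 → b k.2 < 0 → L k.2 x ≤ L k.1 x} := by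
    ext x; simp [hS', Prod.forall]
  rw [this]
  refine IsPolyhedron.inter (IsPolyhedron.iInter fun i => ?_) (IsPolyhedron.iInter fun k => ?_)
  · by_cases hi : b i = 0
    · simpa [hi] using IsPolyhedron.halfspace (a i) (c i)
    · simpa [hi] using IsPolyhedron.univ
  · by_cases hk : 0 < b k.1 ∧ b k.2 < 0
    · convert IsPolyhedron.halfspace ((b k.1)⁻¹ • a k.1 - (b k.2)⁻¹ • a k.2)
        (c k.1 / b k.1 - c k.2 / b k.2) using 1
      ext x
      simp only [Set.mem_ofPred_eq, hk.1, hk.2, true_implies, hL, LinearMap.sub_apply,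
        LinearMap.smul_apply, smul_eq_mul, div_eq_inv_mul]
      constructor <;> intro h <;> linarith
    · convert IsPolyhedron.univ (X := X) using 1
      ext x
      simp only [Set.mem_ofPred_eq, Set.mem_univ, iff_true]
      exact fun h1 h2 => absurd ⟨h1, h2⟩ hk

/-- Elimination of finitely many real variables. -/
lemma IsPolyhedron.eliminate_pi {X : Type*} [NormedAddCommGroup X] [NormedSpace ℝ X]
    [FiniteDimensional ℝ X] (d : ℕ) {S : Set (X × (Fin d → ℝ))} (h : IsPolyhedron S) :
    IsPolyhedron (Prod.fst '' S) ∧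
      ∃ C : ℝ, 0 ≤ C ∧ ∀ x ∈ Prod.fst '' S, ∃ t, (x, t) ∈ S ∧ ‖t‖ ≤ C * (1 + ‖x‖) := by
  induction d with
  | zero =>
    have : Prod.fst '' S = (LinearMap.inl ℝ X (Fin 0 → ℝ)) ⁻¹' S := by
      ext x
      constructor
      · rintro ⟨⟨x, t⟩, h, rfl⟩
        have : t = 0 := Subsingleton.elim _ _
        subst this; exact h
      · intro hx; exact ⟨_, hx, rfl⟩
    refine ⟨this ▸ h.preimage _, 0, le_rfl, ?_⟩
    intro x hx
    rw [this] at hx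
    exact ⟨0, hx, by simp⟩
  | succ d ih =>
    -- Regroup `X × ℝ^(d+1)` as `(X × ℝ^d) × ℝ`.
    set J : ((X × (Fin d → ℝ)) × ℝ) →ₗ[ℝ] X × (Fin (d + 1) → ℝ) :=
      { toFun := fun y => (y.1.1, Fin.cons y.2 y.1.2)
        map_add' := fun y z => by
          refine Prod.ext rfl (funext fun i => ?_)
          refine Fin.cases ?_ (fun i => ?_) i <;> simp
        map_smul' := fun r y => by
          refine Prod.ext rfl (funext fun i => ?_)
          refine Fin.cases ?_ (fun i => ?_) i <;> simp } with hJ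
    obtain ⟨h1, C1, hC1, hs1⟩ := (h.preimage J).eliminate_real
    obtain ⟨h2, C2, hC2, hs2⟩ := ih h1
    have hproj : Prod.fst '' S = Prod.fst '' (Prod.fst '' (J ⁻¹' S)) := by
      ext x
      constructor
      · rintro ⟨⟨x, t⟩, h, rfl⟩
        refine ⟨(x, Fin.tail t), ⟨((x, Fin.tail t), t 0), ?_, rfl⟩, rfl⟩
        simpa [hJ] using h
      · rintro ⟨_, ⟨⟨⟨x, s⟩, t⟩, h, rfl⟩, rfl⟩
        exact ⟨_, h, rfl⟩
    rw [hproj]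
    refine ⟨h2, C2 + C1 * (1 + C2), by positivity, fun x hx => ?_⟩
    obtain ⟨s, hs, hsn⟩ := hs2 x hx
    obtain ⟨t, ht, htn⟩ := hs1 _ hs
    refine ⟨Fin.cons t s, ht, ?_⟩
    have hx0 := norm_nonneg x
    have hxs : ‖(x, s)‖ ≤ ‖x‖ + C2 * (1 + ‖x‖) := by
      rw [Prod.norm_mk]
      exact max_le (le_add_of_nonneg_right (by positivity)) (hsn.trans (by linarith))
    have htn' : ‖t‖ ≤ C1 * (1 + C2) * (1 + ‖x‖) := by
      refine htn.trans ?_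
      calc C1 * (1 + ‖(x, s)‖) ≤ C1 * (1 + (‖x‖ + C2 * (1 + ‖x‖))) := by gcongr
        _ = _ := by ring
    rw [pi_norm_le_iff_of_nonneg (by positivity)]
    refine Fin.cases ?_ (fun i => ?_)
    · simp only [Fin.cons_zero]
      nlinarith [mul_nonneg hC2 (by positivity : 0 ≤ 1 + ‖x‖)]
    · simp only [Fin.cons_succ]
      have := (norm_le_pi_norm s i).trans hsn
      have : 0 ≤ C1 * (1 + C2) * (1 + ‖x‖) := by positivity
      linarith

/-- Elimination of a finite-dimensional variable: the projection of a polyhedron is a polyhedron,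
and its points have preimages of at most linear growth. -/
lemma IsPolyhedron.eliminate {X Y : Type*} [NormedAddCommGroup X] [NormedSpace ℝ X]
    [FiniteDimensional ℝ X] [NormedAddCommGroup Y] [NormedSpace ℝ Y] [FiniteDimensional ℝ Y]
    {S : Set (X × Y)} (h : IsPolyhedron S) :
    IsPolyhedron (Prod.fst '' S) ∧
      ∃ C : ℝ, 0 ≤ C ∧ ∀ x ∈ Prod.fst '' S, ∃ y, (x, y) ∈ S ∧ ‖y‖ ≤ C * (1 + ‖x‖) := by
  set e : Y ≃ₗ[ℝ] (Fin (Module.finrank ℝ Y) → ℝ) := (Module.finBasis ℝ Y).equivFun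
  set J := LinearMap.prodMap (LinearMap.id : X →ₗ[ℝ] X) e.symm.toLinearMap
  obtain ⟨h1, C, hC, hs⟩ := (h.preimage J).eliminate_pi
  have hproj : Prod.fst '' S = Prod.fst '' (J ⁻¹' S) := by
    ext x
    constructor
    · rintro ⟨⟨x, y⟩, h, rfl⟩
      exact ⟨(x, e y), by simpa [J] using h, rfl⟩
    · rintro ⟨⟨x, t⟩, h, rfl⟩
      exact ⟨_, h, rfl⟩
  rw [hproj]
  set eL := LinearMap.toContinuousLinearMap e.symm.toLinearMap
  refine ⟨h1, ‖eL‖ * C, by positivity, fun x hx => ?_⟩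
  obtain ⟨t, ht, htn⟩ := hs x hx
  refine ⟨e.symm t, ht, ?_⟩
  calc ‖e.symm t‖ ≤ ‖eL‖ * ‖t‖ := eL.le_opNorm t
    _ ≤ ‖eL‖ * (C * (1 + ‖x‖)) := by gcongr
    _ = _ := by ring

lemma IsPolyhedron.ker {X : Type*} [AddCommGroup X] [Module ℝ X] {a : ℕ} (L : X →ₗ[ℝ] E a) :
    IsPolyhedron {x | L x = 0} := by
  set c : Fin a → X →ₗ[ℝ] ℝ := fun j => (EuclideanSpace.proj (𝕜 := ℝ) j).toLinearMap ∘ₗ L with hc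
  have : {x | L x = 0} = ⋂ j, ({x | c j x ≤ 0} ∩ {x | (-c j) x ≤ 0}) := by
    ext x
    simp only [Set.mem_ofPred_eq, Set.mem_iInter, Set.mem_inter_iff, LinearMap.neg_apply,
      Left.neg_nonpos_iff, ← le_antisymm_iff]
    constructor
    · intro h j; simp [hc, h]
    · intro h; ext j; exact h j
  rw [this]
  exact IsPolyhedron.iInter fun j => (IsPolyhedron.halfspace _ _).inter (IsPolyhedron.halfspace _ _)

lemma IsPolyhedron.pdiff {n : ℕ} {S B : Set (E n)} (hS : IsPolyhedron S)
    (hB : Bornology.IsBounded B) : IsPolyhedron (pdiff S B) :=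
  hS.inter (hS.setOf_forall_add_mem fun f =>
    ((LinearMap.toContinuousLinearMap f).lipschitz.isBounded_image hB).bddAbove)

namespace Data

variable {n m mw p q r : ℕ} (D : Data n m mw p q r)

/-! ### The disturbance set and invariant sets -/

lemma ae_mem_WW : ∀ᵐ w ∂D.ν, w ∈ D.WW := Measure.support_mem_ae

lemma isClosed_WW : IsClosed D.WW := Measure.isClosed_support

/-- The mean of a distribution lies in the closed convex hull of its support. -/
lemma zero_mem_WW (hmean : ∫ w, w ∂D.ν = 0) (hWbdd : Bornology.IsBounded D.WW)
    (hWconv : Convex ℝ D.WW) : (0 : E mw) ∈ D.WW := by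
  obtain ⟨C, hC⟩ := hWbdd.exists_norm_le
  have hint : Integrable (fun w : E mw => w) D.ν :=
    Integrable.of_bound aestronglyMeasurable_id C (D.ae_mem_WW.mono fun w hw => hC w hw)
  rw [← hmean]
  exact hWconv.integral_mem D.isClosed_WW D.ae_mem_WW hint

lemma isBounded_BwW (hWbdd : Bornology.IsBounded D.WW) : Bornology.IsBounded D.BwW :=
  (mvL D.Bw).lipschitz.isBounded_image hWbdd

lemma mv_Acl (x : E n) : mv D.Acl x = mv D.A x + mv D.B (mv D.K x) := by
  rw [Acl, add_mv, mv_mul]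

lemma IsRPI.mv_Acl_mem {S : Set (E n)} (hS : D.IsRPI S) (h0 : (0 : E mw) ∈ D.WW) {x : E n}
    (hx : x ∈ S) : mv D.Acl x ∈ S := by
  simpa using hS x hx 0 h0

lemma IsRPI.mv_Acl_pow_mem {S : Set (E n)} (hS : D.IsRPI S) (h0 : (0 : E mw) ∈ D.WW) {x : E n}
    (hx : x ∈ S) (k : ℕ) : mv (D.Acl ^ k) x ∈ S := by
  induction k with
  | zero => simpa using hx
  | succ k ih => rw [pow_succ_mv]; exact IsRPI.mv_Acl_mem D hS h0 ih

lemma isClosed_Xf : IsClosed D.Xf := by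
  have : D.Xf = ⋂ j, {x | mv D.Hf x j ≤ D.hf j} := by ext; simp [Xf]
  rw [this]
  exact isClosed_iInter fun j => isClosed_le
    ((EuclideanSpace.proj j).continuous.comp (continuous_mv D.Hf)) continuous_const

lemma isClosed_Xinf : IsClosed D.Xinf := isClosed_sInter fun _ hS => hS.2.1

lemma isRPI_Xinf : D.IsRPI D.Xinf := fun x hx w hw S hS => hS.2.2 x (hx S hS) w hw

lemma zero_mem_Xinf (hSchur : IsSchur D.Acl) (h0 : (0 : E mw) ∈ D.WW) : (0 : E n) ∈ D.Xinf := by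
  rintro S ⟨⟨x, hx⟩, hcl, hS⟩
  exact hcl.mem_of_tendsto (hSchur.tendsto_mv_pow x)
    (Eventually.of_forall fun k => IsRPI.mv_Acl_pow_mem D hS h0 hx k)

/-! ### Completion of squares for the linear-quadratic problem -/

lemma nom_succ' (x : E n) (v : ℕ → E m) (l : ℕ) :
    D.nom x v (l + 1) = D.nom (mv D.A x + mv D.B (v 0)) (fun i => v (i + 1)) l := by
  induction l with
  | zero => rfl
  | succ l ih => rw [nom, ih]; rfl

lemma nom_feedback (x : E n) (l : ℕ) :
    D.nom x (fun k => mv D.K (mv (D.Acl ^ k) x)) l = mv (D.Acl ^ l) x := by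
  induction l with
  | zero => simp [nom]
  | succ l ih => rw [nom, ih, pow_succ_mv, mv_Acl]

lemma quad_P_Acl (hP : D.Acl.transpose * D.P * D.Acl + D.Q + D.K.transpose * D.R * D.K = D.P)
    (x : E n) : quad D.P (mv D.Acl x) + quad D.Q x + quad D.R (mv D.K x) = quad D.P x := by
  conv_rhs => rw [← hP]
  rw [add_quad, add_quad, quad_transpose_mul_mul, quad_transpose_mul_mul]

lemma sum_stage_feedback
    (hP : D.Acl.transpose * D.P * D.Acl + D.Q + D.K.transpose * D.R * D.K = D.P) (x : E n)
    (N : ℕ) : ∑ k ∈ Finset.range N, (quad D.Q (mv (D.Acl ^ k) x)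
      + quad D.R (mv D.K (mv (D.Acl ^ k) x))) = quad D.P x - quad D.P (mv (D.Acl ^ N) x) := by
  induction N with
  | zero => simp
  | succ N ih =>
    rw [Finset.sum_range_succ, ih, pow_succ_mv]
    linarith [D.quad_P_Acl hP (mv (D.Acl ^ N) x)]

lemma tendsto_quad_P (hSchur : IsSchur D.Acl) (x : E n) :
    Tendsto (fun k => quad D.P (mv (D.Acl ^ k) x)) atTop (𝓝 0) := by
  have := ((continuous_quad D.P).tendsto 0).comp (hSchur.tendsto_mv_pow x)
  rwa [quad_zero] at this

lemma quad_P_nonneg (hQ : D.Q.PosDef) (hR : D.R.PosDef) (hSchur : IsSchur D.Acl)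
    (hP : D.Acl.transpose * D.P * D.Acl + D.Q + D.K.transpose * D.R * D.K = D.P) (x : E n) :
    0 ≤ quad D.P x := by
  refine le_of_tendsto (D.tendsto_quad_P hSchur x) (Eventually.of_forall fun N => ?_)
  have h1 := D.sum_stage_feedback hP x N
  have h2 : 0 ≤ ∑ k ∈ Finset.range N, (quad D.Q (mv (D.Acl ^ k) x)
      + quad D.R (mv D.K (mv (D.Acl ^ k) x))) :=
    Finset.sum_nonneg fun k _ => add_nonneg (quad_nonneg hQ _) (quad_nonneg hR _)
  linarith

lemma lqCost_feedback (hQ : D.Q.PosDef) (hR : D.R.PosDef) (hSchur : IsSchur D.Acl)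
    (hP : D.Acl.transpose * D.P * D.Acl + D.Q + D.K.transpose * D.R * D.K = D.P) (x : E n) :
    D.lqCost x (fun k => mv D.K (mv (D.Acl ^ k) x)) = ENNReal.ofReal (quad D.P x) := by
  unfold lqCost
  refine tendsto_nhds_unique (ENNReal.tendsto_nat_tsum _) ?_
  have h : ∀ N, ∑ k ∈ Finset.range N, ENNReal.ofReal
      (quad D.Q (D.nom x (fun k => mv D.K (mv (D.Acl ^ k) x)) k)
        + quad D.R (mv D.K (mv (D.Acl ^ k) x)))
      = ENNReal.ofReal (quad D.P x - quad D.P (mv (D.Acl ^ N) x)) := by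
    intro N
    rw [← ENNReal.ofReal_sum_of_nonneg
      (fun k _ => add_nonneg (quad_nonneg hQ _) (quad_nonneg hR _)), ← D.sum_stage_feedback hP x N]
    simp only [nom_feedback]
  simp only [h]
  refine ENNReal.tendsto_ofReal ?_
  simpa using (D.tendsto_quad_P hSchur x).const_sub (quad D.P x)

/-- The excess cost `dᵀ (R + Bᵀ P B) d` of deviating by `d` from the feedback for one step. -/
def excess (d : E m) : ℝ := quad D.R d + quad D.P (mv D.B d)

/-- The one-step comparison of `K x + d` followed by the feedback with the feedback itself. -/
lemma quad_P_le_of_isLQOptimal (hQ : D.Q.PosDef) (hR : D.R.PosDef) (hSchur : IsSchur D.Acl)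
    (hP : D.Acl.transpose * D.P * D.Acl + D.Q + D.K.transpose * D.R * D.K = D.P)
    (hLQ : D.IsLQOptimal) (x : E n) (d : E m) :
    quad D.P x ≤ quad D.Q x + quad D.R (mv D.K x + d) + quad D.P (mv D.Acl x + mv D.B d) := by
  set y := mv D.Acl x + mv D.B d with hy
  set u : ℕ → E m := fun k => Nat.casesOn k (mv D.K x + d) (fun k => mv D.K (mv (D.Acl ^ k) y))
    with hu
  have h0 : mv D.A x + mv D.B (u 0) = y := by
    change mv D.A x + mv D.B (mv D.K x + d) = y
    rw [hy, mv_add, mv_Acl]; abel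
  have h1 : D.lqCost x u = ENNReal.ofReal (quad D.Q x + quad D.R (mv D.K x + d))
      + ENNReal.ofReal (quad D.P y) := by
    rw [lqCost, tsum_eq_zero_add' ENNReal.summable, ← D.lqCost_feedback hQ hR hSchur hP y, lqCost]
    simp only [nom_succ', h0]
    rfl
  have h2 := hLQ x u
  rw [D.lqCost_feedback hQ hR hSchur hP, h1, ← ENNReal.ofReal_add
    (add_nonneg (quad_nonneg hQ _) (quad_nonneg hR _)) (D.quad_P_nonneg hQ hR hSchur hP _)] at h2
  exact (ENNReal.ofReal_le_ofReal_iff (add_nonneg (add_nonneg (quad_nonneg hQ _) (quad_nonneg hR _))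
    (D.quad_P_nonneg hQ hR hSchur hP _))).1 h2

/-- Bellman's equation with the square completed: optimality of `K` annihilates the term that is
linear in the deviation `d`. -/
lemma stage_add_quad_P (hQ : D.Q.PosDef) (hR : D.R.PosDef) (hSchur : IsSchur D.Acl)
    (hP : D.Acl.transpose * D.P * D.Acl + D.Q + D.K.transpose * D.R * D.K = D.P)
    (hLQ : D.IsLQOptimal) (x : E n) (d : E m) :
    quad D.Q x + quad D.R (mv D.K x + d) + quad D.P (mv D.Acl x + mv D.B d)
      = quad D.P x + D.excess d := by
  set c := polar D.R (mv D.K x) d + polar D.P (mv D.Acl x) (mv D.B d) with hc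
  have hpoly : ∀ t : ℝ, 0 ≤ t * c + t ^ 2 * D.excess d := by
    intro t
    have h := D.quad_P_le_of_isLQOptimal hQ hR hSchur hP hLQ x (t • d)
    rw [mv_smul, quad_add, quad_add, polar_smul_right, polar_smul_right, quad_smul, quad_smul] at h
    have h' := D.quad_P_Acl hP x
    rw [excess, hc]
    linarith
  have hc0 : c = 0 := by
    by_contra hne
    have hs : 0 ≤ D.excess d := by
      have h1 := hpoly 1
      have h2 := hpoly (-1)
      linarith
    have h := hpoly (-c / (D.excess d + 1))
    have hpos : 0 < D.excess d + 1 := by linarith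
    have : -c / (D.excess d + 1) * c + (-c / (D.excess d + 1)) ^ 2 * D.excess d
        = -(c ^ 2 / (D.excess d + 1) ^ 2) := by
      field_simp; ring
    rw [this] at h
    have : 0 < c ^ 2 / (D.excess d + 1) ^ 2 := by positivity
    linarith
  have h' := D.quad_P_Acl hP x
  rw [quad_add, quad_add, excess]
  linarith

/-- Deviation of a plan from the feedback along its nominal trajectory. -/
def dev (x : E n) (v : ℕ → E m) (l : ℕ) : E m := v l - mv D.K (D.nom x v l)

/-- Total excess cost of a plan over the horizon. -/
def excessSum (x : E n) (v : ℕ → E m) : ℝ := ∑ l ∈ Finset.range D.T, D.excess (D.dev x v l)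

lemma cost_eq (hQ : D.Q.PosDef) (hR : D.R.PosDef) (hSchur : IsSchur D.Acl)
    (hP : D.Acl.transpose * D.P * D.Acl + D.Q + D.K.transpose * D.R * D.K = D.P)
    (hLQ : D.IsLQOptimal) (x : E n) (v : ℕ → E m) :
    D.cost x v = quad D.P x + D.excessSum x v := by
  have key : ∀ N, (∑ l ∈ Finset.range N, (quad D.Q (D.nom x v l) + quad D.R (v l)))
      + quad D.P (D.nom x v N) = quad D.P x + ∑ l ∈ Finset.range N, D.excess (D.dev x v l) := by
    intro N
    induction N with
    | zero => simp [nom]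
    | succ N ih =>
      have h := D.stage_add_quad_P hQ hR hSchur hP hLQ (D.nom x v N) (D.dev x v N)
      have h1 : mv D.K (D.nom x v N) + D.dev x v N = v N := by simp [dev]
      have h2 : mv D.Acl (D.nom x v N) + mv D.B (D.dev x v N) = D.nom x v (N + 1) := by
        rw [mv_Acl, add_assoc, ← mv_add, h1]; rfl
      rw [h1, h2] at h
      rw [Finset.sum_range_succ, Finset.sum_range_succ]
      linarith
  exact key D.T

lemma quad_R_le_excess (hQ : D.Q.PosDef) (hR : D.R.PosDef) (hSchur : IsSchur D.Acl)
    (hP : D.Acl.transpose * D.P * D.Acl + D.Q + D.K.transpose * D.R * D.K = D.P) (d : E m) :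
    quad D.R d ≤ D.excess d :=
  le_add_of_nonneg_right (D.quad_P_nonneg hQ hR hSchur hP _)

lemma excess_nonneg (hQ : D.Q.PosDef) (hR : D.R.PosDef) (hSchur : IsSchur D.Acl)
    (hP : D.Acl.transpose * D.P * D.Acl + D.Q + D.K.transpose * D.R * D.K = D.P) (d : E m) :
    0 ≤ D.excess d :=
  (quad_nonneg hR d).trans (D.quad_R_le_excess hQ hR hSchur hP d)

lemma excessSum_nonneg (hQ : D.Q.PosDef) (hR : D.R.PosDef) (hSchur : IsSchur D.Acl)
    (hP : D.Acl.transpose * D.P * D.Acl + D.Q + D.K.transpose * D.R * D.K = D.P) (x : E n)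
    (v : ℕ → E m) : 0 ≤ D.excessSum x v :=
  Finset.sum_nonneg fun _ _ => D.excess_nonneg hQ hR hSchur hP _

@[simp] lemma excess_zero : D.excess 0 = 0 := by simp [excess]

/-! ### The candidate plan -/

lemma candidate_of_lt (x : E n) (v : ℕ → E m) (w : E mw) {i : ℕ} (hi : i + 1 < D.T) :
    D.candidate x v w i = v (i + 1) + mv D.K (mv (D.Acl ^ i) (mv D.Bw w)) := if_pos hi

/-- The candidate trajectory is the shifted plan plus the propagated disturbance. -/
lemma nom_candidate (x : E n) (v : ℕ → E m) (w : E mw) {i : ℕ} (hi : i < D.T) :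
    D.nom (mv D.A x + mv D.B (v 0) + mv D.Bw w) (D.candidate x v w) i
      = D.nom x v (i + 1) + mv (D.Acl ^ i) (mv D.Bw w) := by
  induction i with
  | zero => simp [nom]
  | succ i ih =>
    have h : D.nom x v (i + 1 + 1) = mv D.A (D.nom x v (i + 1)) + mv D.B (v (i + 1)) := rfl
    rw [nom, ih (by omega), D.candidate_of_lt x v w hi, pow_succ_mv, mv_Acl, h, mv_add, mv_add]
    abel

/-- Passing to the candidate plan removes exactly the first excess term. -/
lemma excessSum_candidate (x : E n) (v : ℕ → E m) (w : E mw) (hT : 1 ≤ D.T) :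
    D.excessSum (mv D.A x + mv D.B (v 0) + mv D.Bw w) (D.candidate x v w)
      + D.excess (D.dev x v 0) = D.excessSum x v := by
  obtain ⟨t, ht⟩ : ∃ t, D.T = t + 1 := ⟨D.T - 1, by omega⟩
  have hlt : ∀ i < t, D.dev (mv D.A x + mv D.B (v 0) + mv D.Bw w) (D.candidate x v w) i
      = D.dev x v (i + 1) := by
    intro i hi
    rw [dev, D.nom_candidate x v w (by omega), D.candidate_of_lt x v w (by omega), dev, mv_add]
    abel
  have hlast : D.dev (mv D.A x + mv D.B (v 0) + mv D.Bw w) (D.candidate x v w) t = 0 := by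
    rw [dev, D.nom_candidate x v w (by omega), candidate, if_neg (by omega), ht, sub_self]
  rw [excessSum, excessSum, ht, Finset.sum_range_succ, Finset.sum_range_succ', hlast, excess_zero,
    add_zero, Finset.sum_congr rfl fun i hi => by rw [hlt i (Finset.mem_range.1 hi)]]

/-! ### Prediction errors and constraint tightening on the terminal region -/

lemma measurable_error_step :
    Measurable (fun y : E n × E mw => mv D.Acl y.1 + mv D.Bw y.2) :=
  (((continuous_mv _).comp continuous_fst).add ((continuous_mv _).comp continuous_snd)).measurable

instance (l : ℕ) : IsProbabilityMeasure (D.errLaw l) := by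
  induction l with
  | zero => rw [errLaw]; infer_instance
  | succ l ih =>
    rw [errLaw]
    exact Measure.isProbabilityMeasure_map D.measurable_error_step.aemeasurable

lemma continuous_mv_apply {a b : ℕ} (M : Matrix (Fin a) (Fin b) ℝ) (j : Fin a) :
    Continuous fun e => mv M e j :=
  (EuclideanSpace.proj (𝕜 := ℝ) j).continuous.comp (continuous_mv M)

lemma measurableSet_le_sub {a b : ℕ} (M : Matrix (Fin a) (Fin b) ℝ) (j : Fin a) (η c : ℝ) :
    MeasurableSet {e | η ≤ c - mv M e j} :=
  measurableSet_le measurable_const ((continuous_mv_apply M j).measurable.const_sub c)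

lemma le_chanceBound {a : E n → ℝ} {c δ η : ℝ} {l : ℕ}
    (h : ENNReal.ofReal (1 - δ) ≤ D.errLaw l {e | η ≤ c - a e}) :
    (η : EReal) ≤ D.chanceBound a c δ l :=
  le_sSup ⟨η, h, rfl⟩

/-- Every real number up to the supremum defining the bound satisfies the chance constraint; at the
supremum itself this is continuity of the measure from above. -/
lemma le_measure_of_le_chanceBound {b : ℕ} (M : Matrix (Fin b) (Fin n) ℝ) (j : Fin b)
    {c δ η : ℝ} {l : ℕ} (h : (η : EReal) ≤ D.chanceBound (fun e => mv M e j) c δ l) :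
    ENNReal.ofReal (1 - δ) ≤ D.errLaw l {e | η ≤ c - mv M e j} := by
  set s : ℕ → Set (E n) := fun k => {e | η - 1 / ((k : ℝ) + 1) ≤ c - mv M e j} with hs
  have hinter : {e | η ≤ c - mv M e j} = ⋂ k, s k := by
    ext e
    simp only [Set.mem_ofPred_eq, Set.mem_iInter, hs]
    refine ⟨fun h k => ?_, fun h => ?_⟩
    · have : 0 < 1 / ((k : ℝ) + 1) := by positivity
      linarith
    · refine le_of_forall_pos_le_add fun ε hε => ?_
      obtain ⟨k, hk⟩ := exists_nat_one_div_lt hε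
      linarith [h k]
  have hanti : Antitone s := by
    intro k k' hk e he
    have : 1 / ((k' : ℝ) + 1) ≤ 1 / ((k : ℝ) + 1) := by gcongr
    simp only [hs, Set.mem_ofPred_eq] at he ⊢
    linarith
  have hlim := tendsto_measure_iInter_atTop (μ := D.errLaw l)
    (fun k => (measurableSet_le_sub M j (η - 1 / ((k : ℝ) + 1)) c : MeasurableSet (s k)).nullMeasurableSet)
    hanti
    ⟨0, measure_ne_top _ _⟩
  rw [hinter]
  refine ge_of_tendsto hlim (Eventually.of_forall fun k => ?_)
  have hlt : ((η - 1 / ((k : ℝ) + 1) : ℝ) : EReal) < D.chanceBound (fun e => mv M e j) c δ l := by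
    refine lt_of_lt_of_le (EReal.coe_lt_coe_iff.2 ?_) h
    have : 0 < 1 / ((k : ℝ) + 1) := by positivity
    linarith
  obtain ⟨_, ⟨η', hη', rfl⟩, hlt'⟩ := lt_sSup_iff.1 hlt
  have hlt'' := EReal.coe_lt_coe_iff.1 hlt'
  exact le_trans hη' (measure_mono fun e he => hlt''.le.trans he)

/-- Started in the terminal region, the linear closed loop stays there almost surely. -/
lemma ae_add_mem_Xf (hXf : D.IsRPI D.Xf) {x : E n} (hx : x ∈ D.Xf) (l : ℕ) :
    ∀ᵐ e ∂D.errLaw l, mv (D.Acl ^ l) x + e ∈ D.Xf := by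
  induction l with
  | zero =>
    rw [errLaw, ae_dirac_iff ((D.isClosed_Xf.preimage (continuous_const_add _)).measurableSet)]
    simpa using hx
  | succ l ih =>
    have hm : MeasurableSet {e | mv (D.Acl ^ (l + 1)) x + e ∈ D.Xf} :=
      (D.isClosed_Xf.preimage (continuous_const_add _)).measurableSet
    rw [errLaw, ae_map_iff D.measurable_error_step.aemeasurable hm]
    refine (Measure.ae_prod_iff_ae_ae (D.measurable_error_step hm)).2 ?_
    filter_upwards [ih] with e he
    filter_upwards [D.ae_mem_WW] with w hw
    have := hXf _ he w hw
    rw [mv_add, ← pow_succ_mv] at this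
    rwa [← add_assoc]

lemma le_eta_succ (hXf : D.IsRPI D.Xf) (hXf' : D.Xf ⊆ D.XfTilde) {x : E n} (hx : x ∈ D.Xf) (l : ℕ)
    (j : Fin p) : ((mv D.H (mv (D.Acl ^ (l + 1)) x) j : ℝ) : EReal) ≤ D.eta (l + 1) j := by
  refine D.le_chanceBound ?_
  set η := mv D.H (mv (D.Acl ^ (l + 1)) x) j with hη
  have hm := measurableSet_le_sub D.H j η (D.h j)
  rw [errLaw, Measure.map_apply D.measurable_error_step hm,
    Measure.prod_apply (D.measurable_error_step hm)]
  calc ENNReal.ofReal (1 - D.ε j) = ∫⁻ _, ENNReal.ofReal (1 - D.ε j) ∂D.errLaw l := by simp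
    _ ≤ _ := lintegral_mono_ae ?_
  filter_upwards [D.ae_add_mem_Xf hXf hx l] with e he
  have h1 := D.le_measure_of_le_chanceBound D.H j ((hXf' he).1 j)
  rw [errLaw, errLaw, Measure.map_apply D.measurable_error_step (measurableSet_le_sub _ _ _ _),
    Measure.dirac_prod, Measure.map_apply (by fun_prop)
      (D.measurable_error_step (measurableSet_le_sub _ _ _ _))] at h1
  refine h1.trans (measure_mono fun w hw => ?_)
  simp only [Set.mem_preimage, Set.mem_ofPred_eq, mv_zero, zero_add, mv_mul, mv_add,
    ← pow_succ_mv, PiLp.add_apply] at hw ⊢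
  linarith

lemma le_mu (hXf : D.IsRPI D.Xf) (hXf' : D.Xf ⊆ D.XfTilde) (hεu : 0 ≤ D.εu) {x : E n}
    (hx : x ∈ D.Xf) (l : ℕ) (j : Fin q) :
    ((mv (D.G * D.K) (mv (D.Acl ^ l) x) j : ℝ) : EReal) ≤ D.mu l j := by
  refine D.le_chanceBound ?_
  refine (ENNReal.ofReal_le_one.2 (by linarith)).trans_eq (Eq.symm ?_)
  refine (mem_ae_iff_prob_eq_one (measurableSet_le_sub _ _ _ _)).1 ?_
  filter_upwards [D.ae_add_mem_Xf hXf hx l] with e he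
  have := (hXf' he).2 j
  rw [mv_add, PiLp.add_apply] at this
  linarith

lemma le_etaf (hXf : D.IsRPI D.Xf) (hεf : 0 ≤ D.εf) {x : E n} (hx : x ∈ D.Xf) (l : ℕ)
    (j : Fin r) : ((mv D.Hf (mv (D.Acl ^ l) x) j : ℝ) : EReal) ≤ D.etaf l j := by
  refine D.le_chanceBound ?_
  refine (ENNReal.ofReal_le_one.2 (by linarith)).trans_eq (Eq.symm ?_)
  refine (mem_ae_iff_prob_eq_one (measurableSet_le_sub _ _ _ _)).1 ?_
  filter_upwards [D.ae_add_mem_Xf hXf hx l] with e he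
  have := he j
  rw [mv_add, PiLp.add_apply] at this
  linarith

/-- The worst-case term of the refined tightening is finite from below for a bounded confidence
region, so that adding an infinite bound to it gives no constraint. -/
lemma hatBound_ne_bot {Wf : Set (E mw)} (hb : Bornology.IsBounded Wf) {b : ℕ}
    (M : Matrix (Fin b) (Fin n) ℝ) (j : Fin b) (i l : ℕ) :
    D.hatBound Wf (fun e => mv M e j) i l ≠ ⊥ := by
  obtain ⟨ρ, hρ⟩ := hb.exists_norm_le
  set C := ‖mvL M‖ * ∑ κ ∈ Finset.Icc 1 i, ‖mvL (D.Acl ^ (l - κ))‖ * (‖mvL D.Bw‖ * ρ) with hC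
  have hle : ((-C : ℝ) : EReal) ≤ D.hatBound Wf (fun e => mv M e j) i l := by
    refine le_iInf₂ fun w hw => EReal.coe_le_coe_iff.2 (neg_le_neg ?_)
    calc mv M (∑ κ ∈ Finset.Icc 1 i, mv (D.Acl ^ (l - κ)) (mv D.Bw (w κ))) j
        ≤ ‖mv M (∑ κ ∈ Finset.Icc 1 i, mv (D.Acl ^ (l - κ)) (mv D.Bw (w κ)))‖ :=
          (le_abs_self _).trans (by simpa using PiLp.norm_apply_le (mv M _) j)
      _ ≤ ‖mvL M‖ * ‖∑ κ ∈ Finset.Icc 1 i, mv (D.Acl ^ (l - κ)) (mv D.Bw (w κ))‖ :=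
          (mvL M).le_opNorm _
      _ ≤ C := by
          refine mul_le_mul_of_nonneg_left ?_ (norm_nonneg _)
          refine norm_sum_le_of_le _ fun κ _ => ?_
          refine ((mvL (D.Acl ^ (l - κ))).le_opNorm _).trans ?_
          refine mul_le_mul_of_nonneg_left ?_ (norm_nonneg _)
          exact ((mvL D.Bw).le_opNorm _).trans
            (mul_le_mul_of_nonneg_left (hρ _ (hw κ)) (norm_nonneg _))
  exact ne_bot_of_le_ne_bot (EReal.coe_ne_bot _) hle

lemma le_hatBound_add {Wf : Set (E mw)} (hne : Wf.Nonempty) (hb : Bornology.IsBounded Wf) {b : ℕ}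
    (M : Matrix (Fin b) (Fin n) ℝ) (j : Fin b) (i l : ℕ) (c : ℝ) (t : EReal)
    (h : ∀ w : ℕ → E mw, (∀ κ, w κ ∈ Wf) →
      ((c + mv M (∑ κ ∈ Finset.Icc 1 i, mv (D.Acl ^ (l - κ)) (mv D.Bw (w κ))) j : ℝ) : EReal)
        ≤ t) :
    (c : EReal) ≤ D.hatBound Wf (fun e => mv M e j) i l + t := by
  induction t with
  | bot =>
    obtain ⟨w, hw⟩ := hne
    exact absurd (le_bot_iff.1 (h (fun _ => w) fun _ => hw)) (EReal.coe_ne_bot _)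
  | top => rw [EReal.add_top_of_ne_bot (D.hatBound_ne_bot hb M j i l)]; exact le_top
  | coe t =>
    have : ((c - t : ℝ) : EReal) ≤ D.hatBound Wf (fun e => mv M e j) i l := by
      refine le_iInf₂ fun w hw => EReal.coe_le_coe_iff.2 ?_
      have := EReal.coe_le_coe_iff.1 (h w hw)
      linarith
    calc (c : EReal) = ((c - t : ℝ) : EReal) + (t : EReal) := by
          rw [← EReal.coe_add, sub_add_cancel]
      _ ≤ _ := by gcongr

/-- Robust invariance absorbs the first `i` disturbances into a state of the terminal region. -/
lemma exists_mem_Xf_prediction (hXf : D.IsRPI D.Xf) {x : E n} (hx : x ∈ D.Xf) {w : ℕ → E mw}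
    (hw : ∀ κ, w κ ∈ D.WW) (i : ℕ) :
    ∃ y ∈ D.Xf, ∀ l, i ≤ l → mv (D.Acl ^ l) x
      + ∑ κ ∈ Finset.Icc 1 i, mv (D.Acl ^ (l - κ)) (mv D.Bw (w κ)) = mv (D.Acl ^ (l - i)) y := by
  induction i with
  | zero => exact ⟨x, hx, fun l _ => by simp⟩
  | succ i ih =>
    obtain ⟨y, hy, h⟩ := ih
    refine ⟨_, hXf y hy (w (i + 1)) (hw _), fun l hl => ?_⟩
    rw [Finset.sum_Icc_succ_top (by omega), ← add_assoc, h l (by omega), mv_add, ← pow_succ_mv',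
      show l - i = l - (i + 1) + 1 by omega]

/-- On the terminal region the feedback `K` satisfies all nominal constraints. -/
lemma nomFeasible_feedback {τ : Tightening p q r} (hWbdd : Bornology.IsBounded D.WW)
    (hεu : 0 ≤ D.εu) (hεf : 0 ≤ D.εf ∧ D.εf < 1)
    (hXf : D.IsRPI D.Xf) (hXf' : D.Xf ⊆ D.XfTilde) (hτ : D.IsTightening τ) {x : E n}
    (hx : x ∈ D.Xf) : D.NomFeasible τ x (fun k => mv D.K (mv (D.Acl ^ k) x)) := by
  simp only [NomFeasible, nom_feedback, ← mv_mul D.G D.K]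
  rcases hτ with rfl | ⟨Wf, hWf, -, hprob, rfl⟩
  · refine ⟨fun l hl _ j => ?_, fun l _ j => D.le_mu hXf hXf' hεu hx l j, fun j =>
      D.le_etaf hXf hεf.1 hx _ j⟩
    obtain ⟨l, rfl⟩ := Nat.exists_eq_add_of_le' hl
    exact D.le_eta_succ hXf hXf' hx l j
  · have hne : Wf.Nonempty := by
      rw [Set.nonempty_iff_ne_empty]
      rintro rfl
      rw [measure_empty, nonpos_iff_eq_zero, ENNReal.ofReal_eq_zero] at hprob
      linarith [hεf.2]
    have hb : Bornology.IsBounded Wf := hWbdd.subset hWf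
    have key : ∀ {b : ℕ} (M : Matrix (Fin b) (Fin n) ℝ) (j : Fin b) (i l : ℕ) (t : EReal),
        i ≤ l → (∀ y ∈ D.Xf, ((mv M (mv (D.Acl ^ (l - i)) y) j : ℝ) : EReal) ≤ t) →
        ((mv M (mv (D.Acl ^ l) x) j : ℝ) : EReal)
          ≤ D.hatBound Wf (fun e => mv M e j) i l + t := by
      intro b M j i l t hil ht
      refine D.le_hatBound_add hne hb M j i l _ t fun w hw => ?_
      obtain ⟨y, hy, h⟩ := D.exists_mem_Xf_prediction hXf hx (fun κ => hWf (hw κ)) i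
      rw [← PiLp.add_apply, ← mv_add, h l hil]
      exact ht y hy
    refine ⟨fun l hl _ j => le_iInf fun i => ?_, fun l _ j => le_iInf fun i => ?_,
      fun j => le_iInf fun i => ?_⟩
    · refine key D.H j i l _ i.2.le fun y hy => ?_
      obtain ⟨k, hk⟩ : ∃ k, l - i = k + 1 := ⟨l - i - 1, by have := i.2; omega⟩
      rw [hk]
      exact D.le_eta_succ hXf hXf' hy k j
    · exact key _ j i l _ (Nat.lt_succ_iff.1 i.2) fun y hy => D.le_mu hXf hXf' hεu hy _ j
    · exact key _ j i D.T _ (Nat.lt_succ_iff.1 i.2) fun y hy => D.le_etaf hXf hεf.1 hy _ j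

lemma Xf_subset_CTx {τ : Tightening p q r} (h0 : (0 : E mw) ∈ D.WW)
    (hWbdd : Bornology.IsBounded D.WW) (hεu : 0 ≤ D.εu) (hεf : 0 ≤ D.εf ∧ D.εf < 1)
    (hXf : D.IsRPI D.Xf) (hXf' : D.Xf ⊆ D.XfTilde) (hτ : D.IsTightening τ) (i : ℕ) :
    D.Xf ⊆ D.CTx τ i := by
  have hCT : ∀ x ∈ D.Xf, (x, mv D.K x) ∈ D.CT τ := fun x hx =>
    ⟨_, by simp, D.nomFeasible_feedback hWbdd hεu hεf hXf hXf' hτ hx⟩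
  induction i with
  | zero => exact fun x hx => ⟨_, hCT x hx, rfl⟩
  | succ i ih =>
    refine fun x hx => ⟨ih hx, _, hCT x hx, ?_⟩
    rw [← mv_Acl]
    refine ⟨ih (IsRPI.mv_Acl_mem D hXf h0 hx), ?_⟩
    rintro _ ⟨w, hw, rfl⟩
    exact ih (hXf x hx w hw)

/-! ### Polyhedral structure of the feasible sets -/

/-- The nominal state after `l` steps as a linear map of initial state and input sequence. -/
def nomL : ℕ → (E n × (ℕ → E m)) →ₗ[ℝ] E n
  | 0 => LinearMap.fst ℝ _ _
  | l + 1 => (mvL D.A).toLinearMap ∘ₗ nomL l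
      + (mvL D.B).toLinearMap ∘ₗ LinearMap.proj l ∘ₗ LinearMap.snd ℝ _ _

lemma nomL_apply (l : ℕ) (y : E n × (ℕ → E m)) : D.nomL l y = D.nom y.1 y.2 l := by
  induction l with
  | zero => rfl
  | succ l ih => simp [nomL, nom, ih]

lemma nom_congr {x : E n} {v v' : ℕ → E m} {l : ℕ} (h : ∀ i < l, v i = v' i) :
    D.nom x v l = D.nom x v' l := by
  induction l with
  | zero => rfl
  | succ l ih => rw [nom, nom, ih fun i hi => h i (by omega), h l (by omega)]

lemma NomFeasible.congr {τ : Tightening p q r} {x : E n} {v v' : ℕ → E m}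
    (hv : D.NomFeasible τ x v) (h : ∀ i < D.T, v i = v' i) : D.NomFeasible τ x v' := by
  have hn : ∀ l ≤ D.T, D.nom x v' l = D.nom x v l := fun l hl =>
    D.nom_congr fun i hi => (h i (by omega)).symm
  refine ⟨fun l h1 h2 j => ?_, fun l hl j => ?_, fun j => ?_⟩
  · rw [hn l h2]; exact hv.1 l h1 h2 j
  · rw [← h l hl]; exact hv.2.1 l hl j
  · rw [hn _ le_rfl]; exact hv.2.2 j

lemma isPolyhedron_nomFeasible (τ : Tightening p q r) :
    IsPolyhedron {y : E n × (ℕ → E m) | D.NomFeasible τ y.1 y.2} := by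
  let row {b c : ℕ} (M : Matrix (Fin b) (Fin c) ℝ) (j : Fin b) : E c →ₗ[ℝ] ℝ :=
    (EuclideanSpace.proj (𝕜 := ℝ) j).toLinearMap ∘ₗ (mvL M).toLinearMap
  have : {y : E n × (ℕ → E m) | D.NomFeasible τ y.1 y.2} =
      (⋂ k : Fin D.T × Fin p,
        {y | (((row D.H k.2 ∘ₗ D.nomL (k.1 + 1)) y : ℝ) : EReal) ≤ τ.state (k.1 + 1) k.2}) ∩
      ((⋂ k : Fin D.T × Fin q, {y : E n × (ℕ → E m) |
        (((row D.G k.2 ∘ₗ LinearMap.proj k.1.1 ∘ₗ LinearMap.snd ℝ _ _) y : ℝ) : EReal)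
          ≤ τ.input k.1 k.2}) ∩
      ⋂ j : Fin r, {y | (((row D.Hf j ∘ₗ D.nomL D.T) y : ℝ) : EReal) ≤ τ.term j}) := by
    ext y
    simp only [NomFeasible, Set.mem_ofPred_eq, Set.mem_inter_iff, Set.mem_iInter, Prod.forall,
      LinearMap.comp_apply, nomL_apply, row]
    refine and_congr ⟨fun h l j => h (l + 1) (by omega) (by omega) j, fun h l h1 h2 j => ?_⟩
      (and_congr ⟨fun h l j => h l l.2 j, fun h l hl j => h ⟨l, hl⟩ j⟩ Iff.rfl)
    obtain ⟨k, rfl⟩ := Nat.exists_eq_add_of_le' h1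
    exact h ⟨k, by omega⟩ j
  rw [this]
  exact (IsPolyhedron.iInter fun _ => IsPolyhedron.ereal_le _ _).inter
    ((IsPolyhedron.iInter fun _ => IsPolyhedron.ereal_le _ _).inter
      (IsPolyhedron.iInter fun _ => IsPolyhedron.ereal_le _ _))

/-- Pairs of a state and the nominal successor state under some nominally feasible plan. -/
def stepPairs (τ : Tightening p q r) : Set (E n × E n) :=
  {y | ∃ v, D.NomFeasible τ y.1 v ∧ D.nom y.1 v 1 = y.2}

/-- The successor relation is polyhedral, and it is realized by plans of linear growth. -/
lemma stepPairs_eliminate (τ : Tightening p q r) (hT : 1 ≤ D.T) :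
    IsPolyhedron (D.stepPairs τ) ∧ ∃ C : ℝ, 0 ≤ C ∧ ∀ y ∈ D.stepPairs τ, ∃ v,
      D.NomFeasible τ y.1 v ∧ D.nom y.1 v 1 = y.2 ∧ ∀ l, ‖v l‖ ≤ C * (1 + ‖y‖) := by
  -- Extension of a plan on the horizon by zero.
  set ext : (Fin D.T → E m) →ₗ[ℝ] (ℕ → E m) :=
    LinearMap.pi fun l => if h : l < D.T then LinearMap.proj ⟨l, h⟩ else 0 with hext
  have ext_apply : ∀ (V : Fin D.T → E m) (l : ℕ) (h : l < D.T), ext V l = V ⟨l, h⟩ := by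
    intro V l h; simp [hext, h]
  have ext_norm : ∀ (V : Fin D.T → E m) (l : ℕ), ‖ext V l‖ ≤ ‖V‖ := by
    intro V l
    by_cases h : l < D.T
    · rw [ext_apply V l h]; exact norm_le_pi_norm V _
    · simp [hext, h]
  set J : ((E n × E n) × (Fin D.T → E m)) →ₗ[ℝ] E n × (ℕ → E m) :=
    LinearMap.prodMap (LinearMap.fst ℝ _ _) ext with hJ
  set L : ((E n × E n) × (Fin D.T → E m)) →ₗ[ℝ] E n :=
    D.nomL 1 ∘ₗ J - LinearMap.snd ℝ _ _ ∘ₗ LinearMap.fst ℝ _ _ with hL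
  have hpoly : IsPolyhedron ((J ⁻¹' {y | D.NomFeasible τ y.1 y.2}) ∩ {z | L z = 0}) :=
    ((D.isPolyhedron_nomFeasible τ).preimage J).inter (IsPolyhedron.ker L)
  have hmem : ∀ y V, (y, V) ∈ (J ⁻¹' {y | D.NomFeasible τ y.1 y.2}) ∩ {z | L z = 0} ↔
      D.NomFeasible τ y.1 (ext V) ∧ D.nom y.1 (ext V) 1 = y.2 := by
    intro y V
    simp only [Set.mem_inter_iff, Set.mem_preimage, Set.mem_ofPred_eq, hL, LinearMap.sub_apply,
      LinearMap.comp_apply, nomL_apply, sub_eq_zero]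
    rfl
  have hproj : D.stepPairs τ =
      Prod.fst '' ((J ⁻¹' {y | D.NomFeasible τ y.1 y.2}) ∩ {z | L z = 0}) := by
    ext y
    constructor
    · rintro ⟨v, hv, hv1⟩
      have hagree : ∀ i < D.T, v i = ext (fun l => v l) i := fun i hi => by rw [ext_apply _ i hi]
      refine ⟨(y, fun l => v l), (hmem _ _).2 ⟨NomFeasible.congr D hv hagree, ?_⟩, rfl⟩
      rw [← hv1]
      exact (D.nom_congr fun i hi => hagree i (by omega)).symm
    · rintro ⟨⟨y, V⟩, h, rfl⟩
      exact ⟨ext V, (hmem _ _).1 h⟩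
  obtain ⟨h1, C, hC, hs⟩ := hpoly.eliminate
  rw [hproj]
  refine ⟨h1, C, hC, fun y hy => ?_⟩
  obtain ⟨V, hV, hVn⟩ := hs y hy
  exact ⟨ext V, ((hmem _ _).1 hV).1, ((hmem _ _).1 hV).2, fun l => (ext_norm V l).trans hVn⟩

lemma mem_CTx_zero_iff (τ : Tightening p q r) (x : E n) :
    x ∈ D.CTx τ 0 ↔ ∃ y, (x, y) ∈ D.stepPairs τ := by
  constructor
  · rintro ⟨⟨x, u⟩, ⟨v, -, hv⟩, rfl⟩
    exact ⟨D.nom x v 1, v, hv, rfl⟩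
  · rintro ⟨y, v, hv, -⟩
    exact ⟨(x, v 0), ⟨v, rfl, hv⟩, rfl⟩

lemma mem_CTx_succ_iff (τ : Tightening p q r) (i : ℕ) (x : E n) :
    x ∈ D.CTx τ (i + 1) ↔
      x ∈ D.CTx τ i ∧ ∃ y, (x, y) ∈ D.stepPairs τ ∧ y ∈ pdiff (D.CTx τ i) D.BwW := by
  refine and_congr Iff.rfl ⟨?_, ?_⟩
  · rintro ⟨u, ⟨v, rfl, hv⟩, h⟩
    exact ⟨_, ⟨v, hv, rfl⟩, h⟩
  · rintro ⟨y, ⟨v, hv, hv1⟩, h⟩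
    have hy : mv D.A x + mv D.B (v 0) = y := hv1
    exact ⟨v 0, ⟨v, rfl, hv⟩, hy ▸ h⟩

lemma isPolyhedron_CTx (τ : Tightening p q r) (hT : 1 ≤ D.T) (hWbdd : Bornology.IsBounded D.WW)
    (i : ℕ) : IsPolyhedron (D.CTx τ i) := by
  have hstep := (D.stepPairs_eliminate τ hT).1
  induction i with
  | zero =>
    have : D.CTx τ 0 = Prod.fst '' D.stepPairs τ := by
      ext x
      simp [mem_CTx_zero_iff]
    rw [this]
    exact hstep.eliminate.1
  | succ i ih =>
    have h2 := (ih.pdiff (D.isBounded_BwW hWbdd)).preimage (LinearMap.snd ℝ (E n) (E n))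
    have : D.CTx τ (i + 1) = D.CTx τ i ∩
        Prod.fst '' (D.stepPairs τ ∩ LinearMap.snd ℝ (E n) (E n) ⁻¹' pdiff (D.CTx τ i) D.BwW) := by
      ext x
      simp [mem_CTx_succ_iff]
    rw [this]
    exact ih.inter (hstep.inter h2).eliminate.1

lemma antitone_CTx (τ : Tightening p q r) : Antitone (D.CTx τ) :=
  antitone_nat_of_succ_le fun _ _ hx => hx.1

/-- Nested closed convex sets with bounded intersection are eventually bounded. -/
lemma exists_CTx_bounded (τ : Tightening p q r) (hT : 1 ≤ D.T) (hWbdd : Bornology.IsBounded D.WW)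
    (hcomp : IsCompact (D.CTinf τ)) (h0 : (0 : E n) ∈ D.CTinf τ) :
    ∃ i, Bornology.IsBounded (D.CTx τ i) := by
  obtain ⟨ρ, hρ0, hρ⟩ := hcomp.isBounded.exists_pos_norm_lt
  have hex : ∃ i, ¬ (D.CTx τ i ∩ Metric.sphere 0 ρ).Nonempty := by
    by_contra! hne
    obtain ⟨x, hx⟩ := IsCompact.nonempty_iInter_of_sequence_nonempty_isCompact_isClosed
      (fun i => D.CTx τ i ∩ Metric.sphere 0 ρ)
      (fun i => Set.inter_subset_inter_left _ (D.antitone_CTx τ (Nat.le_succ i))) hne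
      ((isCompact_sphere _ _).inter_left (D.isPolyhedron_CTx τ hT hWbdd 0).isClosed)
      (fun i => (D.isPolyhedron_CTx τ hT hWbdd i).isClosed.inter Metric.isClosed_sphere)
    simp only [Set.mem_iInter, Set.mem_inter_iff, mem_sphere_zero_iff_norm] at hx
    exact (hρ x (Set.mem_iInter.2 fun i => (hx i).1)).ne (hx 0).2
  obtain ⟨i, hi⟩ := hex
  refine ⟨i, (Metric.isBounded_closedBall (x := (0 : E n)) (r := ρ)).subset fun x hx => ?_⟩
  rw [mem_closedBall_zero_iff]
  by_contra! hlt
  refine hi ⟨(ρ / ‖x‖) • x, ?_, ?_⟩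
  · refine ((D.isPolyhedron_CTx τ hT hWbdd i).convex.starConvex
      (Set.mem_iInter.1 h0 i)).smul_mem hx (by positivity) ?_
    exact div_le_one_of_le₀ hlt.le (norm_nonneg _)
  · have : ‖x‖ ≠ 0 := (hρ0.trans hlt).ne'
    rw [mem_sphere_zero_iff_norm, norm_smul, Real.norm_of_nonneg (by positivity),
      div_mul_cancel₀ _ this]

/-- The online problem admits an admissible first step at every state of `C_{T,x}^∞`; compactness
is needed to interchange the intersection with the choice of the step. -/
lemma exists_step (τ : Tightening p q r) (hT : 1 ≤ D.T) (hWbdd : Bornology.IsBounded D.WW)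
    (hcomp : IsCompact (D.CTinf τ)) (h0 : (0 : E n) ∈ D.CTinf τ) {x : E n} (hx : x ∈ D.CTinf τ) :
    ∃ y, (x, y) ∈ D.stepPairs τ ∧ y ∈ pdiff (D.CTinf τ) D.BwW := by
  obtain ⟨i₀, hi₀⟩ := D.exists_CTx_bounded τ hT hWbdd hcomp h0
  set t : ℕ → Set (E n) := fun i =>
    {y | (x, y) ∈ D.stepPairs τ} ∩ pdiff (D.CTx τ (i₀ + i)) D.BwW with ht
  have hcl : ∀ i, IsClosed (t i) := fun i =>
    ((D.stepPairs_eliminate τ hT).1.isClosed.preimage (by fun_prop)).inter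
      ((D.isPolyhedron_CTx τ hT hWbdd _).pdiff (D.isBounded_BwW hWbdd)).isClosed
  obtain ⟨y, hy⟩ := IsCompact.nonempty_iInter_of_sequence_nonempty_isCompact_isClosed t
    (fun i y hy => ⟨hy.1, D.antitone_CTx τ (by omega) hy.2.1,
      fun b hb => D.antitone_CTx τ (by omega) (hy.2.2 b hb)⟩)
    (fun i => by
      obtain ⟨-, y, h1, h2⟩ := (D.mem_CTx_succ_iff τ (i₀ + i) x).1 (Set.mem_iInter.1 hx _)
      exact ⟨y, h1, h2⟩)
    (Metric.isCompact_of_isClosed_isBounded (hcl 0)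
      (hi₀.subset fun y hy => hy.2.1)) hcl
  rw [Set.mem_iInter] at hy
  refine ⟨y, (hy 0).1, Set.mem_iInter.2 fun i => ?_, fun b hb => Set.mem_iInter.2 fun i => ?_⟩
  · exact D.antitone_CTx τ (Nat.le_add_left i i₀) (hy i).2.1
  · exact D.antitone_CTx τ (Nat.le_add_left i i₀) ((hy i).2.2 b hb)

/-- Feasible plans can be chosen uniformly bounded on `C_{T,x}^∞`. -/
lemma exists_bounded_feasible (τ : Tightening p q r) (hT : 1 ≤ D.T)
    (hWbdd : Bornology.IsBounded D.WW) (hcomp : IsCompact (D.CTinf τ))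
    (h0 : (0 : E n) ∈ D.CTinf τ) :
    ∃ C : ℝ, ∀ x ∈ D.CTinf τ, ∃ v, D.Feasible τ x v ∧ ∀ l, ‖v l‖ ≤ C := by
  obtain ⟨ρ, hρ⟩ := hcomp.isBounded.exists_norm_le
  obtain ⟨-, C, hC, hs⟩ := D.stepPairs_eliminate τ hT
  refine ⟨C * (1 + ρ), fun x hx => ?_⟩
  obtain ⟨y, hxy, hy⟩ := D.exists_step τ hT hWbdd hcomp h0 hx
  obtain ⟨v, hv, hv1, hvn⟩ := hs _ hxy
  refine ⟨v, ⟨hv, ?_⟩, fun l => (hvn l).trans ?_⟩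
  · rw [hv1]; exact hy
  · have : ‖(x, y)‖ ≤ ρ := max_le (hρ x hx) (hρ y hy.1)
    gcongr

lemma continuous_nom (l : ℕ) : Continuous fun y : E n × (ℕ → E m) => D.nom y.1 y.2 l := by
  induction l with
  | zero => exact continuous_fst
  | succ l ih =>
    exact ((continuous_mv _).comp ih).add
      ((continuous_mv _).comp ((continuous_apply l).comp continuous_snd))

/-- The cost of uniformly bounded plans is uniformly bounded on compact sets of states. -/
lemma exists_cost_le {S : Set (E n)} (hS : IsCompact S) (C : ℝ) :
    ∃ c : ℝ, ∀ x ∈ S, ∀ v : ℕ → E m, (∀ l, ‖v l‖ ≤ C) → D.cost x v ≤ c := by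
  have hcont : Continuous fun y : E n × (ℕ → E m) => D.cost y.1 y.2 := by
    unfold cost
    refine Continuous.add (continuous_finsetSum _ fun l _ => Continuous.add ?_ ?_) ?_
    · exact (continuous_quad _).comp (D.continuous_nom l)
    · exact (continuous_quad _).comp ((continuous_apply l).comp continuous_snd)
    · exact (continuous_quad _).comp (D.continuous_nom _)
  have hK : IsCompact (S ×ˢ Set.univ.pi fun _ : ℕ => Metric.closedBall (0 : E m) C) :=
    hS.prod (isCompact_univ_pi fun _ => isCompact_closedBall _ _)
  obtain ⟨c, hc⟩ := (hK.image hcont).bddAbove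
  refine ⟨c, fun x hx v hv => hc ⟨(x, v), ⟨hx, fun l _ => ?_⟩, rfl⟩⟩
  exact mem_closedBall_zero_iff.2 (hv l)

/-! ### The closed loop on `C_{T,x}^∞` and on the terminal region -/

/-- The assumptions on the problem data and on the plan map `π` under which the closed loop is
analysed. Zero mean and convex support of the disturbance enter only through `0 ∈ 𝕎`. -/
structure StandingAssumptions (τ : Tightening p q r) (π : E n → ℕ → E m) : Prop where
  zero_mem_WW : (0 : E mw) ∈ D.WW
  bounded_WW : Bornology.IsBounded D.WW
  one_le_T : 1 ≤ D.T
  εu_nonneg : 0 ≤ D.εu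
  εf_mem : 0 ≤ D.εf ∧ D.εf < 1
  posDef_Q : D.Q.PosDef
  posDef_R : D.R.PosDef
  schur : IsSchur D.Acl
  lyapunov : D.Acl.transpose * D.P * D.Acl + D.Q + D.K.transpose * D.R * D.K = D.P
  isRPI_Xf : D.IsRPI D.Xf
  Xf_subset : D.Xf ⊆ D.XfTilde
  isTightening : D.IsTightening τ
  isOptimalPlan : D.IsOptimalPlan τ π
  isLQOptimal : D.IsLQOptimal
  thickening : ∃ lam : ℝ, 0 < lam ∧
    {x | ∃ a ∈ D.Xinf, ∃ b ∈ Metric.ball (0 : E n) 1, x = a + lam • b} ⊆ D.Xf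
  isCompact_CTinf : IsCompact (D.CTinf τ)

/-- One step of the closed loop under the plan map `π` with disturbance `w`. -/
def step (π : E n → ℕ → E m) (x : E n) (w : E mw) : E n :=
  mv D.A x + mv D.B (π x 0) + mv D.Bw w

/-- The disturbance `w` at the state `x` leaves the shifted optimal plan feasible. -/
def CandidateFeasible (τ : Tightening p q r) (π : E n → ℕ → E m) (x : E n) (w : E mw) : Prop :=
  D.Feasible τ (D.step π x w) (D.candidate x (π x) w)

namespace StandingAssumptions

variable {D} {τ : Tightening p q r} {π : E n → ℕ → E m}

lemma Xf_subset_CTinf (h : D.StandingAssumptions τ π) : D.Xf ⊆ D.CTinf τ := fun _ hx =>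
  Set.mem_iInter.2 fun i => D.Xf_subset_CTx h.zero_mem_WW h.bounded_WW h.εu_nonneg h.εf_mem
    h.isRPI_Xf h.Xf_subset h.isTightening i hx

lemma exists_add_mem_Xf (h : D.StandingAssumptions τ π) :
    ∃ lam : ℝ, 0 < lam ∧ ∀ a ∈ D.Xinf, ∀ e : E n, ‖e‖ < lam → a + e ∈ D.Xf := by
  obtain ⟨lam, hlam, hsub⟩ := h.thickening
  refine ⟨lam, hlam, fun a ha e he => hsub ⟨a, ha, lam⁻¹ • e, ?_, ?_⟩⟩
  · rw [mem_ball_zero_iff, norm_smul, Real.norm_of_nonneg (by positivity), inv_mul_lt_iff₀ hlam,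
      mul_one]
    exact he
  · rw [smul_smul, mul_inv_cancel₀ hlam.ne', one_smul]

lemma zero_mem_Xinf (h : D.StandingAssumptions τ π) : (0 : E n) ∈ D.Xinf :=
  D.zero_mem_Xinf h.schur h.zero_mem_WW

lemma zero_mem_Xf (h : D.StandingAssumptions τ π) : (0 : E n) ∈ D.Xf := by
  obtain ⟨lam, hlam, hsub⟩ := h.exists_add_mem_Xf
  simpa using hsub 0 h.zero_mem_Xinf 0 (by simpa using hlam)

lemma Xinf_subset_Xf (h : D.StandingAssumptions τ π) : D.Xinf ⊆ D.Xf :=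
  fun _ hx => hx _ ⟨⟨0, h.zero_mem_Xf⟩, D.isClosed_Xf, h.isRPI_Xf⟩

lemma isCompact_Xinf (h : D.StandingAssumptions τ π) : IsCompact D.Xinf :=
  h.isCompact_CTinf.of_isClosed_subset D.isClosed_Xinf (h.Xinf_subset_Xf.trans h.Xf_subset_CTinf)

lemma Xf_mem_nhdsSet (h : D.StandingAssumptions τ π) : D.Xf ∈ 𝓝ˢ D.Xinf := by
  obtain ⟨lam, hlam, hsub⟩ := h.exists_add_mem_Xf
  refine mem_nhdsSet_iff_forall.2 fun a ha => Metric.mem_nhds_iff.2 ⟨lam, hlam, fun x hx => ?_⟩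
  rw [← add_sub_cancel a x]
  exact hsub a ha _ (by rwa [mem_ball_iff_norm] at hx)

lemma exists_bounded_feasible (h : D.StandingAssumptions τ π) :
    ∃ C : ℝ, ∀ x ∈ D.CTinf τ, ∃ v, D.Feasible τ x v ∧ ∀ l, ‖v l‖ ≤ C :=
  D.exists_bounded_feasible τ h.one_le_T h.bounded_WW h.isCompact_CTinf
    (h.Xf_subset_CTinf h.zero_mem_Xf)

lemma isOptimal (h : D.StandingAssumptions τ π) {x : E n} (hx : x ∈ D.CTinf τ) :
    D.IsOptimal τ x (π x) := by
  obtain ⟨C, hC⟩ := h.exists_bounded_feasible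
  obtain ⟨v, hv, -⟩ := hC x hx
  exact h.isOptimalPlan x ⟨v, hv⟩

lemma step_mem_CTinf (h : D.StandingAssumptions τ π) {x : E n} (hx : x ∈ D.CTinf τ) {w : E mw}
    (hw : w ∈ D.WW) : D.step π x w ∈ D.CTinf τ :=
  (h.isOptimal hx).1.2.2 _ ⟨w, hw, rfl⟩

lemma cost_eq (h : D.StandingAssumptions τ π) (x : E n) (v : ℕ → E m) :
    D.cost x v = quad D.P x + D.excessSum x v :=
  D.cost_eq h.posDef_Q h.posDef_R h.schur h.lyapunov h.isLQOptimal x v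

lemma excess_nonneg (h : D.StandingAssumptions τ π) (d : E m) : 0 ≤ D.excess d :=
  D.excess_nonneg h.posDef_Q h.posDef_R h.schur h.lyapunov d

lemma excessSum_nonneg (h : D.StandingAssumptions τ π) (x : E n) (v : ℕ → E m) :
    0 ≤ D.excessSum x v :=
  D.excessSum_nonneg h.posDef_Q h.posDef_R h.schur h.lyapunov x v

lemma exists_le_excess (h : D.StandingAssumptions τ π) :
    ∃ c : ℝ, 0 < c ∧ ∀ d, c * ‖d‖ ^ 2 ≤ D.excess d := by
  obtain ⟨c, hc, hle⟩ := exists_le_quad h.posDef_R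
  exact ⟨c, hc, fun d => (hle d).trans
    (D.quad_R_le_excess h.posDef_Q h.posDef_R h.schur h.lyapunov d)⟩

/-- Minimality of the cost is minimality of the excess, as the two differ by a function of the
state. -/
lemma excessSum_le (h : D.StandingAssumptions τ π) {x : E n} (hx : x ∈ D.CTinf τ) {v : ℕ → E m}
    (hv : D.Feasible τ x v) : D.excessSum x (π x) ≤ D.excessSum x v := by
  have := (h.isOptimal hx).2 v hv
  rw [h.cost_eq, h.cost_eq] at this
  linarith

/-- In the terminal region the controller coincides with the feedback `K`, whose plan is feasible
and has no excess cost. -/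
lemma plan_eq_of_mem_Xf (h : D.StandingAssumptions τ π) {x : E n} (hx : x ∈ D.Xf) :
    π x 0 = mv D.K x := by
  set v : ℕ → E m := fun k => mv D.K (mv (D.Acl ^ k) x) with hv
  have hfeas : D.Feasible τ x v := by
    refine ⟨D.nomFeasible_feedback h.bounded_WW h.εu_nonneg h.εf_mem h.isRPI_Xf h.Xf_subset
      h.isTightening hx, ?_⟩
    rw [hv, nom_feedback, pow_one]
    refine ⟨h.Xf_subset_CTinf (IsRPI.mv_Acl_mem D h.isRPI_Xf h.zero_mem_WW hx), ?_⟩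
    rintro _ ⟨w, hw, rfl⟩
    exact h.Xf_subset_CTinf (h.isRPI_Xf x hx w hw)
  have h0 : D.excessSum x v = 0 :=
    Finset.sum_eq_zero fun l _ => by rw [dev, hv, nom_feedback, sub_self, excess_zero]
  have h1 : D.excessSum x (π x) ≤ 0 := h0 ▸ h.excessSum_le (h.Xf_subset_CTinf hx) hfeas
  have h2 : D.excess (D.dev x (π x) 0) ≤ D.excessSum x (π x) :=
    Finset.single_le_sum (f := fun l => D.excess (D.dev x (π x) l))
      (fun l _ => h.excess_nonneg _) (Finset.mem_range.2 h.one_le_T)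
  obtain ⟨c, hc, hle⟩ := h.exists_le_excess
  have h3 : ‖D.dev x (π x) 0‖ ^ 2 ≤ 0 := by
    have := hle (D.dev x (π x) 0)
    by_contra! hpos
    have := mul_pos hc hpos
    linarith
  have h4 : D.dev x (π x) 0 = 0 := by
    rw [← norm_eq_zero]
    exact pow_eq_zero_iff two_ne_zero |>.1 (le_antisymm h3 (sq_nonneg _))
  exact sub_eq_zero.1 h4

lemma step_of_mem_Xf (h : D.StandingAssumptions τ π) {x : E n} (hx : x ∈ D.Xf) (w : E mw) :
    D.step π x w = mv D.Acl x + mv D.Bw w := by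
  rw [step, h.plan_eq_of_mem_Xf hx, mv_Acl]

lemma step_mem_Xf (h : D.StandingAssumptions τ π) {x : E n} (hx : x ∈ D.Xf) {w : E mw}
    (hw : w ∈ D.WW) : D.step π x w ∈ D.Xf := by
  rw [h.step_of_mem_Xf hx]; exact h.isRPI_Xf x hx w hw

/-- If the shifted plan stays feasible, the optimal excess decreases by the excess of the input
just applied. -/
lemma excessSum_step_le (h : D.StandingAssumptions τ π) {x : E n} (hx : x ∈ D.CTinf τ) {w : E mw}
    (hw : w ∈ D.WW) (hf : D.CandidateFeasible τ π x w) :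
    D.excessSum (D.step π x w) (π (D.step π x w)) + D.excess (D.dev x (π x) 0)
      ≤ D.excessSum x (π x) := by
  rw [← D.excessSum_candidate x (π x) w h.one_le_T]
  exact add_le_add_left (h.excessSum_le (h.step_mem_CTinf hx hw) hf) _

lemma exists_excessSum_le (h : D.StandingAssumptions τ π) :
    ∃ c : ℝ, ∀ x ∈ D.CTinf τ, D.excessSum x (π x) ≤ c := by
  obtain ⟨C, hC⟩ := h.exists_bounded_feasible
  obtain ⟨c, hc⟩ := D.exists_cost_le h.isCompact_CTinf C
  refine ⟨c, fun x hx => ?_⟩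
  obtain ⟨v, hv, hvC⟩ := hC x hx
  refine (h.excessSum_le hx hv).trans (le_trans ?_ (hc x hx v hvC))
  rw [h.cost_eq]
  exact le_add_of_nonneg_left (D.quad_P_nonneg h.posDef_Q h.posDef_R h.schur h.lyapunov x)

end StandingAssumptions

/-! ### Reaching the terminal region while the shifted plans stay feasible -/

/-- States from which the closed loop is in the terminal region after `j` steps, provided the
shifted plan is feasible at each of them. -/
def Reach (τ : Tightening p q r) (π : E n → ℕ → E m) : ℕ → Set (E n)
  | 0 => D.Xf
  | j + 1 => {x | ∀ w ∈ D.WW, D.CandidateFeasible τ π x w → D.step π x w ∈ Reach τ π j}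

namespace StandingAssumptions

variable {D} {τ : Tightening p q r} {π : E n → ℕ → E m}

lemma reach_subset_succ (h : D.StandingAssumptions τ π) (j : ℕ) :
    D.Reach τ π j ⊆ D.Reach τ π (j + 1) := by
  induction j with
  | zero => exact fun x hx w hw _ => h.step_mem_Xf hx hw
  | succ j ih => exact fun x hx w hw hf => ih (hx w hw hf)

lemma monotone_reach (h : D.StandingAssumptions τ π) : Monotone (D.Reach τ π) :=
  monotone_nat_of_le_succ h.reach_subset_succ

/-- Every step applying a deviation of size at least `δ` consumes a fixed amount of excess cost, of
which only a bounded amount is available; `M` consecutive steps with smaller deviations lead from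
a neighbourhood of radius `ρ` into the terminal region. -/
lemma exists_subset_reach (h : D.StandingAssumptions τ π) : ∃ N, D.CTinf τ ⊆ D.Reach τ π N := by
  obtain ⟨lam, hlam, hXf⟩ := h.exists_add_mem_Xf
  obtain ⟨ρ, hρ0, hρ⟩ := h.isCompact_CTinf.isBounded.exists_pos_norm_le
  obtain ⟨c, hc, hcle⟩ := h.exists_le_excess
  obtain ⟨Φ, hΦ⟩ := h.exists_excessSum_le
  -- `M` steps of the undisturbed linear loop contract the region to half the margin.
  obtain ⟨M, hM⟩ : ∃ M, ‖mvL (D.Acl ^ M)‖ * ρ < lam / 2 := by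
    have := h.schur.tendsto_norm_pow.mul_const ρ
    rw [zero_mul] at this
    exact (this.eventually (gt_mem_nhds (by positivity))).exists
  -- Accumulated effect of input deviations of unit size.
  let s : ℕ → ℝ := fun k => Nat.rec 0 (fun _ b => ‖mvL D.Acl‖ * b + ‖mvL D.B‖) k
  have hs_succ : ∀ k, s (k + 1) = ‖mvL D.Acl‖ * s k + ‖mvL D.B‖ := fun k => rfl
  have hs : ∀ k, 0 ≤ s k := by
    intro k
    induction k with
    | zero => exact le_rfl
    | succ k ih => rw [hs_succ]; positivity
  obtain ⟨δ, hδ, hδs⟩ : ∃ δ : ℝ, 0 < δ ∧ δ * s M ≤ lam / 2 := by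
    have hpos : 0 < s M + 1 := by linarith [hs M]
    refine ⟨lam / 2 / (s M + 1), by positivity, ?_⟩
    rw [div_mul_eq_mul_div, div_le_iff₀ hpos]
    gcongr
    linarith
  have key : ∀ L : ℕ, ∀ x ∈ D.CTinf τ, D.excessSum x (π x) < L * (c * δ ^ 2) →
      x ∈ D.Reach τ π (L * M) := by
    intro L
    induction L with
    | zero =>
      intro x _ hlt
      have := h.excessSum_nonneg x (π x)
      simp at hlt
      linarith
    | succ L ih =>
      -- After `i` small deviations the state is `Acl^i x₀ + a + b`, with `a` the contribution of
      -- the disturbances and `b` that of the deviations.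
      have inner : ∀ j i, i + j = M → ∀ x ∈ D.CTinf τ, ∀ x₀ a b : E n,
          x = mv (D.Acl ^ i) x₀ + a + b → ‖x₀‖ ≤ ρ → a ∈ D.Xinf → ‖b‖ ≤ δ * s i →
          D.excessSum x (π x) < (L + 1 : ℕ) * (c * δ ^ 2) → x ∈ D.Reach τ π (L * M + j) := by
        intro j
        induction j with
        | zero =>
          intro i hi x _ x₀ a b hx hx₀ ha hb _
          obtain rfl : i = M := by omega
          have : x ∈ D.Xf := by
            rw [show x = a + (mv (D.Acl ^ i) x₀ + b) by rw [hx]; abel]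
            refine hXf a ha _ ((norm_add_le _ _).trans_lt ?_)
            have h1 : ‖mv (D.Acl ^ i) x₀‖ ≤ ‖mvL (D.Acl ^ i)‖ * ρ :=
              ((mvL (D.Acl ^ i)).le_opNorm x₀).trans (by gcongr)
            linarith
          exact h.monotone_reach (Nat.zero_le _) this
        | succ j ihj =>
          intro i hi x hxC x₀ a b hx hx₀ ha hb hlt w hw hf
          have hdesc := h.excessSum_step_le hxC hw hf
          have hstepC := h.step_mem_CTinf hxC hw
          set d := D.dev x (π x) 0 with hd
          rcases lt_or_ge ‖d‖ δ with hsmall | hlarge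
          · refine ihj (i + 1) (by omega) _ hstepC x₀ (mv D.Acl a + mv D.Bw w)
              (mv D.Acl b + mv D.B d) ?_ hx₀ (D.isRPI_Xinf a ha w hw) ?_ ?_
            · have hu : π x 0 = mv D.K x + d := by simp [hd, dev, nom]
              rw [step, hu, mv_add, ← add_assoc, ← mv_Acl]
              conv_lhs => rw [hx]
              rw [mv_add, mv_add, pow_succ_mv]
              abel
            · rw [hs_succ]
              calc ‖mv D.Acl b + mv D.B d‖ ≤ ‖mvL D.Acl‖ * ‖b‖ + ‖mvL D.B‖ * ‖d‖ :=
                    norm_add_le_of_le ((mvL D.Acl).le_opNorm b) ((mvL D.B).le_opNorm d)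
                _ ≤ ‖mvL D.Acl‖ * (δ * s i) + ‖mvL D.B‖ * δ := by gcongr
                _ = δ * (‖mvL D.Acl‖ * s i + ‖mvL D.B‖) := by ring
            · linarith [h.excess_nonneg d]
          · refine h.monotone_reach (Nat.le_add_right (L * M) j) (ih _ hstepC ?_)
            have h1 : c * δ ^ 2 ≤ D.excess d := le_trans (by gcongr) (hcle d)
            push_cast at hlt
            linarith
      intro x hx hlt
      have := inner M 0 (by omega) x hx x 0 0 (by simp) (hρ x hx) h.zero_mem_Xinf
        (by simpa using mul_nonneg hδ.le (hs 0)) hlt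
      rwa [Nat.succ_mul]
  obtain ⟨L, hL⟩ := exists_nat_gt (Φ / (c * δ ^ 2))
  refine ⟨L * M, fun x hx => key L x hx ?_⟩
  rw [div_lt_iff₀ (by positivity)] at hL
  exact (hΦ x hx).trans_lt hL

end StandingAssumptions

/-! ### The probability of missing the terminal region -/

/-- The probability that the closed loop started at `x` is outside the terminal region after `j`
steps, computed by iterating the transition operator. -/
def missProb (π : E n → ℕ → E m) : ℕ → E n → ℝ≥0∞
  | 0 => D.Xfᶜ.indicator 1
  | j + 1 => fun x => ∫⁻ w, missProb π j (D.step π x w) ∂D.ν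

lemma measurable_step {π : E n → ℕ → E m} (hπ : Measurable π) :
    Measurable fun y : E n × E mw => D.step π y.1 y.2 := by
  have h0 : Measurable fun x => π x 0 := (measurable_pi_apply 0).comp hπ
  exact (((continuous_mv _).measurable.comp measurable_fst).add
    ((continuous_mv _).measurable.comp (h0.comp measurable_fst))).add
    ((continuous_mv _).measurable.comp measurable_snd)

lemma measurable_missProb {π : E n → ℕ → E m} (hπ : Measurable π) (j : ℕ) :
    Measurable (D.missProb π j) := by
  induction j with
  | zero => exact measurable_one.indicator D.isClosed_Xf.measurableSet.compl
  | succ j ih => exact (ih.comp (D.measurable_step hπ)).lintegral_prod_right'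

lemma missProb_le_one (π : E n → ℕ → E m) (j : ℕ) (x : E n) : D.missProb π j x ≤ 1 := by
  induction j generalizing x with
  | zero => exact Set.indicator_le_self' (fun _ _ => zero_le) x
  | succ j ih =>
    calc D.missProb π (j + 1) x ≤ ∫⁻ _, 1 ∂D.ν := lintegral_mono fun w => ih _
      _ = 1 := by simp

namespace StandingAssumptions

variable {D} {τ : Tightening p q r} {π : E n → ℕ → E m}

lemma missProb_eq_zero (h : D.StandingAssumptions τ π) (j : ℕ) {x : E n} (hx : x ∈ D.Xf) :
    D.missProb π j x = 0 := by
  induction j generalizing x with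
  | zero => simp [missProb, hx]
  | succ j ih =>
    refine lintegral_eq_zero_of_ae_eq_zero ?_
    filter_upwards [D.ae_mem_WW] with w hw using ih (h.step_mem_Xf hx hw)

/-- Along each step the shifted plan is feasible with probability at least `1 - β`, where `β` is
the maximal infeasibility probability. Hence the terminal region is missed with a probability
that is bounded away from one. -/
lemma exists_missProb_le (h : D.StandingAssumptions τ π) (hβ : D.maxInfeasProb τ π < 1) (j : ℕ) :
    ∃ γ : ℝ≥0∞, γ < 1 ∧ ∀ x ∈ D.CTinf τ, x ∈ D.Reach τ π j → D.missProb π j x ≤ γ := by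
  set β := D.maxInfeasProb τ π with hβdef
  induction j with
  | zero => exact ⟨0, one_pos, fun x _ hx => (h.missProb_eq_zero 0 hx).le⟩
  | succ j ih =>
    obtain ⟨γ, hγ, hle⟩ := ih
    refine ⟨γ + (1 - γ) * β, ?_, fun x hxC hx => ?_⟩
    · have hpos : 1 - γ ≠ 0 := (tsub_pos_of_lt hγ).ne'
      have hfin : 1 - γ ≠ ∞ := (tsub_le_self.trans_lt ENNReal.one_lt_top).ne
      calc γ + (1 - γ) * β < γ + (1 - γ) * 1 :=
            ENNReal.add_lt_add_left hγ.ne_top ((ENNReal.mul_lt_mul_iff_right hpos hfin).2 hβ)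
        _ = 1 := by rw [mul_one, add_tsub_cancel_of_le hγ.le]
    · -- The set of bad disturbances is not known to be measurable; a measurable hull suffices.
      set s := {w | ¬ D.CandidateFeasible τ π x w} with hs
      have hsβ : D.ν s ≤ β :=
        le_iSup₂_of_le (f := fun x (_ : x ∈ D.CTinf τ) => D.ν {w | ¬ D.Feasible τ
          (mv D.A x + mv D.B (π x 0) + mv D.Bw w) (D.candidate x (π x) w)}) x hxC le_rfl
      calc D.missProb π (j + 1) x
          ≤ ∫⁻ w, (γ + (1 - γ) * (toMeasurable D.ν s).indicator 1 w) ∂D.ν := by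
            refine lintegral_mono_ae ?_
            filter_upwards [D.ae_mem_WW] with w hw
            by_cases hf : D.CandidateFeasible τ π x w
            · exact (hle _ (h.step_mem_CTinf hxC hw) (hx w hw hf)).trans le_self_add
            · have : w ∈ toMeasurable D.ν s := subset_toMeasurable _ _ hf
              rw [Set.indicator_of_mem this, Pi.one_apply, mul_one, add_tsub_cancel_of_le hγ.le]
              exact D.missProb_le_one π j _
        _ = γ + (1 - γ) * D.ν s := by
            rw [lintegral_add_left measurable_const,
              lintegral_const_mul _ (measurable_one.indicator (measurableSet_toMeasurable _ _)),
              lintegral_indicator_one (measurableSet_toMeasurable _ _), measure_toMeasurable]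
            simp
        _ ≤ γ + (1 - γ) * β := by gcongr

lemma missProb_add_le (h : D.StandingAssumptions τ π) {N : ℕ} {γ : ℝ≥0∞} (hγ : γ ≠ ∞)
    (hN : ∀ x ∈ D.CTinf τ, D.missProb π N x ≤ γ) (k : ℕ) {x : E n} (hx : x ∈ D.CTinf τ) :
    D.missProb π (k + N) x ≤ γ * D.missProb π k x := by
  induction k generalizing x with
  | zero =>
    rw [zero_add]
    by_cases hxf : x ∈ D.Xf
    · rw [h.missProb_eq_zero N hxf]; exact zero_le
    · simpa [missProb, hxf] using hN x hx
  | succ k ih =>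
    rw [show k + 1 + N = k + N + 1 by omega, missProb, missProb, ← lintegral_const_mul' _ _ hγ]
    refine lintegral_mono_ae ?_
    filter_upwards [D.ae_mem_WW] with w hw using ih (h.step_mem_CTinf hx hw)

/-- The terminal region is eventually reached with probability one. -/
lemma tendsto_missProb (h : D.StandingAssumptions τ π) (hβ : D.maxInfeasProb τ π < 1) {x : E n}
    (hx : x ∈ D.CTinf τ) : Tendsto (fun j => D.missProb π j x) atTop (𝓝 0) := by
  obtain ⟨N, hN⟩ := h.exists_subset_reach
  obtain ⟨γ, hγ, hle⟩ := h.exists_missProb_le hβ N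
  have hanti : Antitone fun j => D.missProb π j x := antitone_nat_of_succ_le fun j => by
    simpa using h.missProb_add_le (N := 1) ENNReal.one_ne_top
      (fun y _ => D.missProb_le_one π 1 y) j hx
  have hpow : ∀ k, D.missProb π (k * N) x ≤ γ ^ k := by
    intro k
    induction k with
    | zero => simpa using D.missProb_le_one π 0 x
    | succ k ih =>
      rw [Nat.succ_mul, pow_succ']
      exact (h.missProb_add_le hγ.ne_top (fun y hy => hle y hy (hN hy)) _ hx).trans (by gcongr)
  refine tendsto_order.2 ⟨fun a ha => absurd ha (not_lt.2 (zero_le)), fun ε hε => ?_⟩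
  obtain ⟨k, hk⟩ := ((ENNReal.tendsto_pow_atTop_nhds_zero_of_lt_one hγ).eventually
    (gt_mem_nhds hε)).exists
  filter_upwards [eventually_ge_atTop (k * N)] with j hj
  exact ((hanti hj).trans (hpow k)).trans_lt hk

end StandingAssumptions

/-! ### The closed-loop process -/

lemma closedLoop_succ (π : E n → ℕ → E m) (w : ℕ → E mw) (x₀ : E n) (k : ℕ) :
    D.closedLoop (fun x => π x 0) w x₀ (k + 1)
      = D.step π (D.closedLoop (fun x => π x 0) w x₀ k) (w k) := rfl

lemma closedLoop_congr (κ : E n → E m) {w w' : ℕ → E mw} (x₀ : E n) {k : ℕ}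
    (h : ∀ i < k, w i = w' i) : D.closedLoop κ w x₀ k = D.closedLoop κ w' x₀ k := by
  induction k with
  | zero => rfl
  | succ k ih => rw [closedLoop, closedLoop, ih fun i hi => h i (by omega), h k (by omega)]

section Markov

variable {Ω : Type*} [MeasurableSpace Ω] {Pr : Measure Ω} {W : ℕ → Ω → E mw}
  {π : E n → ℕ → E m}

lemma measurable_closedLoop {Ω' : Type*} [MeasurableSpace Ω'] {V : ℕ → Ω' → E mw}
    (hπ : Measurable π) (hV : ∀ k, Measurable (V k)) (x₀ : E n) (k : ℕ) :
    Measurable fun ω => D.closedLoop (fun x => π x 0) (fun i => V i ω) x₀ k := by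
  induction k with
  | zero => exact measurable_const
  | succ k ih =>
    have hpair : Measurable fun ω =>
        (D.closedLoop (fun x => π x 0) (fun i => V i ω) x₀ k, V k ω) := ih.prodMk (hV k)
    have hcomp := (D.measurable_step hπ).comp hpair
    simp only [closedLoop_succ]
    exact hcomp

lemma indepFun_closedLoop (hπ : Measurable π) (hWm : ∀ k, Measurable (W k))
    (hWind : iIndepFun W Pr) (x₀ : E n) (k : ℕ) :
    IndepFun (fun ω => D.closedLoop (fun x => π x 0) (fun i => W i ω) x₀ k) (W k) Pr := by
  classical
  have hind := hWind.indepFun_finset (Finset.range k) {k} (by simp) hWm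
  set V : ℕ → (Finset.range k → E mw) → E mw := fun i y =>
    if hi : i ∈ Finset.range k then y ⟨i, hi⟩ else 0 with hV
  have hVm : ∀ i, Measurable (V i) := by
    intro i
    by_cases hi : i ∈ Finset.range k
    · simpa only [hV, hi, dif_pos] using measurable_pi_apply (⟨i, hi⟩ : Finset.range k)
    · simpa only [hV, hi, dif_neg, not_false_eq_true] using measurable_const
  have := hind.comp (D.measurable_closedLoop hπ hVm x₀ k)
    (measurable_pi_apply (⟨k, by simp⟩ : ({k} : Finset ℕ)))
  have heq : (fun ω => D.closedLoop (fun x => π x 0) (fun i => W i ω) x₀ k)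
      = (fun y => D.closedLoop (fun x => π x 0) (fun i => V i y) x₀ k) ∘
        fun ω (i : Finset.range k) => W i ω := by
    ext1 ω
    refine D.closedLoop_congr _ x₀ fun i hi => ?_
    simp [hV, hi]
  rw [heq]
  exact this

/-- Markov property: averaging over the disturbance at time `k` shifts one step of the transition
operator. -/
lemma lintegral_missProb_closedLoop [IsProbabilityMeasure Pr] (hπ : Measurable π)
    (hWm : ∀ k, Measurable (W k)) (hWlaw : ∀ k, Pr.map (W k) = D.ν) (hWind : iIndepFun W Pr)
    (x₀ : E n) (j k : ℕ) :
    ∫⁻ ω, D.missProb π j (D.closedLoop (fun x => π x 0) (fun i => W i ω) x₀ k) ∂Pr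
      = D.missProb π (j + k) x₀ := by
  induction k generalizing j with
  | zero => simp [closedLoop]
  | succ k ih =>
    set X : Ω → E n := fun ω => D.closedLoop (fun x => π x 0) (fun i => W i ω) x₀ k with hX
    have hXm : Measurable X := D.measurable_closedLoop hπ hWm x₀ k
    have hg : Measurable fun y : E n × E mw => D.missProb π j (D.step π y.1 y.2) :=
      (D.measurable_missProb hπ j).comp (D.measurable_step hπ)
    have hlaw : Pr.map (fun ω => (X ω, W k ω)) = (Pr.map X).prod D.ν := by
      rw [(D.indepFun_closedLoop hπ hWm hWind x₀ k).map_prod_eq_prod_map_map hXm.aemeasurable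
        (hWm k).aemeasurable, hWlaw k]
    calc ∫⁻ ω, D.missProb π j (D.step π (X ω) (W k ω)) ∂Pr
        = ∫⁻ y, D.missProb π j (D.step π y.1 y.2) ∂(Pr.map fun ω => (X ω, W k ω)) :=
          (lintegral_map hg (hXm.prodMk (hWm k))).symm
      _ = ∫⁻ x, D.missProb π (j + 1) x ∂(Pr.map X) := by
          rw [hlaw, lintegral_prod _ hg.aemeasurable]; rfl
      _ = ∫⁻ ω, D.missProb π (j + 1) (X ω) ∂Pr :=
          lintegral_map (D.measurable_missProb hπ _) hXm
      _ = D.missProb π (j + (k + 1)) x₀ := by rw [ih, show j + 1 + k = j + (k + 1) by omega]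

lemma prob_closedLoop_notMem_Xf [IsProbabilityMeasure Pr] (hπ : Measurable π)
    (hWm : ∀ k, Measurable (W k)) (hWlaw : ∀ k, Pr.map (W k) = D.ν) (hWind : iIndepFun W Pr)
    (x₀ : E n) (k : ℕ) :
    Pr {ω | D.closedLoop (fun x => π x 0) (fun i => W i ω) x₀ k ∈ D.Xf}ᶜ = D.missProb π k x₀ := by
  have hm : MeasurableSet {ω | D.closedLoop (fun x => π x 0) (fun i => W i ω) x₀ k ∈ D.Xf} :=
    D.measurable_closedLoop hπ hWm x₀ k D.isClosed_Xf.measurableSet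
  have := D.lintegral_missProb_closedLoop hπ hWm hWlaw hWind x₀ 0 k
  rw [zero_add] at this
  rw [← this, ← lintegral_indicator_one hm.compl]
  rfl

lemma ae_forall_mem_WW (hWm : ∀ k, Measurable (W k)) (hWlaw : ∀ k, Pr.map (W k) = D.ν) :
    ∀ᵐ ω ∂Pr, ∀ k, W k ω ∈ D.WW := by
  refine ae_all_iff.2 fun k => ?_
  have := D.ae_mem_WW
  rw [← hWlaw k] at this
  exact ae_of_ae_map (hWm k).aemeasurable this

end Markov

namespace StandingAssumptions

variable {D} {τ : Tightening p q r} {π : E n → ℕ → E m}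

/-- In the terminal region the closed loop and the linear loop in the minimal invariant set, driven
by the same disturbances, approach each other like the powers of `Acl`. -/
lemma closedLoop_of_mem_Xf (h : D.StandingAssumptions τ π) {w : ℕ → E mw} (hw : ∀ i, w i ∈ D.WW)
    {x₀ : E n} {k : ℕ} (hk : D.closedLoop (fun x => π x 0) w x₀ k ∈ D.Xf) {a : E n}
    (ha : a ∈ D.Xinf) (j : ℕ) :
    D.closedLoop (fun x => π x 0) w x₀ (k + j) ∈ D.Xf ∧ ∃ a' ∈ D.Xinf,
      D.closedLoop (fun x => π x 0) w x₀ (k + j) - a'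
        = mv (D.Acl ^ j) (D.closedLoop (fun x => π x 0) w x₀ k - a) := by
  induction j with
  | zero => exact ⟨hk, a, ha, by simp⟩
  | succ j ih =>
    obtain ⟨hx, a', ha', heq⟩ := ih
    rw [← add_assoc, closedLoop_succ]
    refine ⟨h.step_mem_Xf hx (hw _), _, D.isRPI_Xinf a' ha' _ (hw (k + j)), ?_⟩
    rw [h.step_of_mem_Xf hx, add_sub_add_right_eq_sub, ← mv_sub, heq, pow_succ_mv]

lemma infEDist_closedLoop_le (h : D.StandingAssumptions τ π) {w : ℕ → E mw}
    (hw : ∀ i, w i ∈ D.WW) {x₀ : E n} {k : ℕ}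
    (hk : D.closedLoop (fun x => π x 0) w x₀ k ∈ D.Xf) {a : E n} (ha : a ∈ D.Xinf) (j : ℕ) :
    Metric.infEDist (D.closedLoop (fun x => π x 0) w x₀ (k + j)) D.Xinf ≤
      ENNReal.ofReal (‖mvL (D.Acl ^ j)‖ * dist (D.closedLoop (fun x => π x 0) w x₀ k) a) := by
  obtain ⟨-, a', ha', heq⟩ := h.closedLoop_of_mem_Xf hw hk ha j
  refine (Metric.infEDist_le_edist_of_mem ha').trans ?_
  rw [edist_dist]
  refine ENNReal.ofReal_le_ofReal ?_
  rw [dist_eq_norm, dist_eq_norm, heq]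
  exact (mvL (D.Acl ^ j)).le_opNorm _

end StandingAssumptions

end Data

end SMPC

end

theorem theorem2 {n m mw p q r : ℕ} (D : SMPC.Data n m mw p q r)
    {Ω : Type*} [MeasurableSpace Ω] (Pr : Measure Ω) [IsProbabilityMeasure Pr]
    (W : ℕ → Ω → SMPC.E mw)
    (τ : SMPC.Tightening p q r) (π : SMPC.E n → ℕ → SMPC.E m)
    -- disturbance: i.i.d. with law `ν`, zero mean, bounded convex support
    (hWm : ∀ k, Measurable (W k)) (hWlaw : ∀ k, Pr.map (W k) = D.ν) (hWind : iIndepFun W Pr)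
    (hmean : ∫ w, w ∂D.ν = 0)
    (hWbdd : Bornology.IsBounded D.WW) (hWconv : Convex ℝ D.WW)
    -- horizon and probability levels
    (hT : 1 ≤ D.T) (hε : ∀ j, 0 ≤ D.ε j ∧ D.ε j ≤ 1)
    (hεu : 0 ≤ D.εu ∧ D.εu < 1) (hεf : 0 ≤ D.εf ∧ D.εf < 1)
    -- cost, stabilizing gain, terminal weight
    (hQ : D.Q.PosDef) (hR : D.R.PosDef) (hSchur : SMPC.IsSchur D.Acl)
    (hP : D.Acl.transpose * D.P * D.Acl + D.Q + D.K.transpose * D.R * D.K = D.P)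
    -- terminal region
    (hXf : D.IsRPI D.Xf) (hXf' : D.Xf ⊆ D.XfTilde)
    -- constraint tightening and controller
    (hτ : D.IsTightening τ) (hπm : Measurable π) (hπ : D.IsOptimalPlan τ π)
    (hcand : D.maxInfeasProb τ π < 1)
    -- gain LQ-optimal, terminal region around the minimal invariant set, compactness
    (hLQ : D.IsLQOptimal)
    (hlam : ∃ lam : ℝ, 0 < lam ∧
      {x | ∃ a ∈ D.Xinf, ∃ b ∈ Metric.ball (0 : SMPC.E n) 1, x = a + lam • b} ⊆ D.Xf)
    (hcomp : IsCompact (D.CTinf τ)) :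
    SMPC.AsympStableInProb Pr
      (fun x₀ k ω => D.closedLoop (fun x => π x 0) (fun i => W i ω) x₀ k)
      D.Xinf (D.CTinf τ) := by
  have h : D.StandingAssumptions τ π :=
    { zero_mem_WW := D.zero_mem_WW hmean hWbdd hWconv, bounded_WW := hWbdd, one_le_T := hT,
      εu_nonneg := hεu.1, εf_mem := hεf, posDef_Q := hQ, posDef_R := hR, schur := hSchur,
      lyapunov := hP, isRPI_Xf := hXf, Xf_subset := hXf', isTightening := hτ,
      isOptimalPlan := hπ, isLQOptimal := hLQ, thickening := hlam, isCompact_CTinf := hcomp }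
  have hae := D.ae_forall_mem_WW hWm hWlaw
  refine ⟨h.isCompact_Xinf, mem_of_superset h.Xf_mem_nhdsSet h.Xf_subset_CTinf, ?_, ?_⟩
  · intro ε hε ρ _ _
    obtain ⟨lam, hlam, hadd⟩ := h.exists_add_mem_Xf
    obtain ⟨C, hC⟩ := hSchur.tendsto_norm_pow.bddAbove_range
    have hC' : ∀ j, ‖SMPC.mvL (D.Acl ^ j)‖ ≤ C := fun j => hC ⟨j, rfl⟩
    have hC0 : 0 ≤ C := (norm_nonneg _).trans (hC' 0)
    refine ⟨min (lam / 2) (ε / 2 / (C + 1)), by positivity, fun x₀ hx₀ => ?_⟩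
    -- From a nearby initial state the loop is linear, so the event has probability zero.
    obtain ⟨a, ha, hdist⟩ := h.isCompact_Xinf.exists_infEDist_eq_edist ⟨0, h.zero_mem_Xinf⟩ x₀
    rw [hdist, edist_dist, ENNReal.ofReal_le_ofReal_iff (by positivity), le_min_iff] at hx₀
    have hx₀f : x₀ ∈ D.Xf := by
      rw [← add_sub_cancel a x₀]
      exact hadd a ha _ (by rw [← dist_eq_norm]; linarith [hx₀.1])
    refine le_of_eq_of_le (measure_eq_zero_iff_ae_notMem.2 ?_) (zero_le)
    filter_upwards [hae] with ω hω
    simp only [not_le]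
    refine lt_of_le_of_lt (iSup_le fun k => ?_)
      ((ENNReal.ofReal_lt_ofReal_iff hε).2 (half_lt_self hε))
    have hk := h.infEDist_closedLoop_le hω (k := 0) (x₀ := x₀) hx₀f ha k
    rw [zero_add] at hk
    refine hk.trans (ENNReal.ofReal_le_ofReal ?_)
    calc ‖SMPC.mvL (D.Acl ^ k)‖ * dist x₀ a ≤ (C + 1) * (ε / 2 / (C + 1)) := by
          gcongr
          · exact (hC' k).trans (by linarith)
          · exact hx₀.2
      _ = ε / 2 := by field_simp
  · intro ε₂ hε₂ x₀ hx₀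
    obtain ⟨ρ, hρ⟩ := hcomp.isBounded.exists_norm_le
    -- `J` steps in the terminal region bring the loop uniformly close to the invariant set.
    obtain ⟨J, hJ⟩ : ∃ J, ∀ j ≥ J, ‖SMPC.mvL (D.Acl ^ j)‖ * ρ < ε₂ / 2 := by
      have := hSchur.tendsto_norm_pow.mul_const ρ
      rw [zero_mul] at this
      exact eventually_atTop.1 (this.eventually (gt_mem_nhds (by positivity)))
    have hlim : Tendsto (fun k' : ℕ => 1 - D.missProb π (k' - J) x₀) atTop (𝓝 1) := by
      have h1 := (h.tendsto_missProb hcand hx₀).comp (tendsto_sub_atTop_nat J)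
      simpa using ENNReal.Tendsto.sub tendsto_const_nhds h1 (Or.inl ENNReal.one_ne_top)
    refine tendsto_of_tendsto_of_tendsto_of_le_of_le' hlim tendsto_const_nhds ?_
      (Eventually.of_forall fun _ => prob_le_one)
    filter_upwards [eventually_ge_atTop J] with k' hk'
    have hm : MeasurableSet
        {ω | D.closedLoop (fun x => π x 0) (fun i => W i ω) x₀ (k' - J) ∈ D.Xf} :=
      D.measurable_closedLoop hπm hWm x₀ _ D.isClosed_Xf.measurableSet
    rw [← D.prob_closedLoop_notMem_Xf hπm hWm hWlaw hWind x₀ (k' - J), prob_compl_eq_one_sub hm,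
      ENNReal.sub_sub_cancel ENNReal.one_ne_top prob_le_one]
    refine measure_mono_ae ?_
    filter_upwards [hae] with ω hω hmem
    refine lt_of_le_of_lt (iSup₂_le fun k hk => ?_)
      ((ENNReal.ofReal_lt_ofReal_iff hε₂).2 (half_lt_self hε₂))
    have hd := h.infEDist_closedLoop_le hω hmem h.zero_mem_Xinf (k - (k' - J))
    rw [show k' - J + (k - (k' - J)) = k by omega, dist_zero_right] at hd
    refine hd.trans (ENNReal.ofReal_le_ofReal (le_trans ?_ (hJ (k - (k' - J)) (by omega)).le))
    exact mul_le_mul_of_nonneg_left (hρ _ (h.Xf_subset_CTinf hmem)) (norm_nonneg _)
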